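/- **Diagrams.** An *extended welded link diagram* is an immersion in $\mathbb R^2$ of finitely many (possibly zero) oriented circles whose only multiple points are transverse double points, finitely many in number, each decorated as a classical positive, classical negative or welded crossing, together with finitely many *wen marks* on the curves, away from the double points, such that every component carries an even number of wen marks. Diagrams are put in general position with respect to the height, so that double points, wen marks, local maxima and local minima have pairwise different heights, and are thus words, read from top to bottom, in elementary diagrams (crossings, wen marks, maxima, minima); isotopy of $\mathbb R^2$ is generated by exchanging the heights of elementary diagrams lying side by side, creating or cancelling a maximum and a minimum on a strand, moving a maximum or minimum of one branch through a double point, and moving a wen mark through a maximum or minimum. An *extended welded braid diagram* on $n\ge 0$ strands consists of $n$ strands, monotone downwards, from $n$ points on a horizontal line to $n$ points on a lower one, with the same decorations of double points and with wen marks. It is a word, read from top to bottom, in $\sigma_i^{\pm1},\rho_i$ ($1\le i\le n-1$) and $\tau_i$ ($1\le i\le n$), where $\sigma_i$ is the classical crossing in which the $(i+1)$-th strand passes over the $i$-th one, $\sigma_i^{-1}$ is the opposite classical crossing, $\rho_i$ is the welded crossing of these strands and $\tau_i$ is a wen mark on the $i$-th strand. It is a *welded braid diagram* if it has no wen marks.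 **Equivalence.** *Braid generalized Reidemeister equivalence* is the equivalence relation on extended welded braid diagrams on $n$ strands generated by isotopy (exchanging the heights of two consecutive letters that involve disjoint sets of strands) and by the following local moves, for all admissible $i$: * classical: $\sigma_i\sigma_i^{-1}\leftrightarrow 1\leftrightarrow\sigma_i^{-1}\sigma_i$ and $\sigma_i\sigma_{i+1}\sigma_i\leftrightarrow\sigma_{i+1}\sigma_i\sigma_{i+1}$; * virtual: $\rho_i\rho_i\leftrightarrow 1$ and $\rho_i\rho_{i+1}\rho_i\leftrightarrow\rho_{i+1}\rho_i\rho_{i+1}$; * mixed: $\rho_{i+1}\rho_i\sigma_{i+1}\leftrightarrow\sigma_i\rho_{i+1}\rho_i$; * welded: $\sigma_{i+1}\sigma_i\rho_{i+1}\leftrightarrow\rho_i\sigma_{i+1}\sigma_i$; * extended: $\tau_i\tau_i\leftrightarrow 1$, $\ \tau_i\rho_i\leftrightarrow\rho_i\tau_{i+1}$, $\ \tau_i\sigma_i\leftrightarrow\sigma_i\tau_{i+1}$, $\ \tau_{i+1}\sigma_i\leftrightarrow\rho_i\sigma_i^{-1}\rho_i\tau_i$. *Generalized Reidemeister equivalence*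 of extended welded link diagrams is generated by isotopy of $\mathbb R^2$, by these local moves, read as unoriented pictures in which each strand may have either orientation, and by the first Reidemeister moves, which create or remove a kink with one crossing, classical (R1) or welded (V1), on a strand. An *extended welded link* is an equivalence class of extended welded link diagrams. **Closure.** The closure of an extended welded braid diagram joins, for each $i$, its $i$-th top point to its $i$-th bottom point by parallel arcs beside the braid. The diagram *can be closed* if every component of the resulting curves carries an even number of wen marks; the closure is then an extended welded link diagram. **Proposition.** For every extended welded link $\ell$ there are an integer $n\ge 0$ and an extended welded braid diagram $b$ on $n$ strands that can be closed, such that the closure of $b$ represents $\ell$ and $b$ is braid generalized Reidemeister equivalent to a welded braid diagram (one without wen marks) on $n$ strands. -/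

import Mathlib

namespace ExtWelded

/-! Planar diagrams are presented by cutting them along horizontal lines. After a small isotopy of
the plane, the double points, the wen marks, the local maxima and the local minima of a diagram lie
at pairwise different heights, and the diagram is then read from top to bottom as a word in
elementary diagrams. Along a horizontal line between two of these heights the strands are numbered
`0, 1, 2, …` from left to right. -/

/-- The direction in which a strand runs through a horizontal line. -/
inductive Dir
  | down
  | up
  deriving DecidableEq

/-- The opposite direction. -/
def Dir.flip : Dir → Dir
  | .down => .up
  | .up => .down

/-- The decoration of a double point. For a classical crossing it is recorded which of the two
strands is the upper one; together with the orientations of the two strands this determines the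
sign. If both strands run downwards, `overRight` is the positive and `overLeft` the negative
classical crossing. -/
inductive Crossing
  /-- classical, the strand from the upper right to the lower left passes over -/
  | overRight
  /-- classical, the strand from the upper left to the lower right passes over -/
  | overLeft
  /-- welded -/
  | welded
  deriving DecidableEq

/-- The decoration of the double point reflected in a vertical line of the plane. -/
def Crossing.mirror : Crossing → Crossing
  | .overRight => .overLeft
  | .overLeft => .overRight
  | .welded => .welded

/-- The elementary diagrams, without the vertical strands beside them. -/
inductive Elem
  /-- two strands that cross -/
  | cross (k : Crossing)
  /-- a wen mark on a strand -/
  | wen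
  /-- a local maximum, with the direction of its left leg (the right leg has the opposite one) -/
  | cap (d : Dir)
  /-- a local minimum -/
  | cup
  deriving DecidableEq

/-- The number of strands at the top of an elementary diagram. -/
def Elem.inp : Elem → ℕ
  | .cross _ => 2
  | .wen => 1
  | .cap _ => 0
  | .cup => 2

/-- The number of strands at the bottom of an elementary diagram. -/
def Elem.out : Elem → ℕ
  | .cross _ => 2
  | .wen => 1
  | .cap _ => 2
  | .cup => 0

/-- `e.Fits u v`: the strands of `e` can be oriented so as to have the directions `u` at the top and
`v` at the bottom. -/
inductive Elem.Fits : Elem → List Dir → List Dir → Prop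
  | cross (k : Crossing) (a b : Dir) : Fits (.cross k) [a, b] [b, a]
  | wen (a : Dir) : Fits .wen [a] [a]
  | cap (d : Dir) : Fits (.cap d) [] [d, d.flip]
  | cup (d : Dir) : Fits .cup [d, d.flip] []

/-- An elementary diagram with `pos` vertical strands to its left, and some vertical strands to its
right. -/
structure Slice where
  pos : ℕ
  elem : Elem
  deriving DecidableEq

/-- `s.Step L M`: the slice `s` joins a horizontal line with directions `L` to the next horizontal
line below it, with directions `M`. -/
def Slice.Step (s : Slice) (L M : List Dir) : Prop :=
  ∃ pre u v post : List Dir, pre.length = s.pos ∧ s.elem.Fits u v ∧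
    L = pre ++ u ++ post ∧ M = pre ++ v ++ post

/-- A word of slices, from top to bottom. -/
abbrev Word := List Slice

/-- `Run w L M`: the word `w` is an oriented diagram with directions `L` along its top and `M` along
its bottom. -/
inductive Run : Word → List Dir → List Dir → Prop
  | nil (L : List Dir) : Run [] L L
  | cons {s : Slice} {w : Word} {L M N : List Dir} : s.Step L M → Run w M N → Run (s :: w) L N

/-- The slices, as short names: `cr k i` is a crossing of the strands `i` and `i + 1`. -/
abbrev cr (k : Crossing) (i : ℕ) : Slice := ⟨i, .cross k⟩

/-- The strand `i + 1` passes over the strand `i` (strands numbered at the top of the slice). -/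
abbrev sig (i : ℕ) : Slice := cr .overRight i

/-- The inverse of `sig i`. -/
abbrev sigInv (i : ℕ) : Slice := cr .overLeft i

/-- The welded crossing of the strands `i` and `i + 1`. -/
abbrev rho (i : ℕ) : Slice := cr .welded i

/-- A wen mark on the strand `i`. -/
abbrev tau (i : ℕ) : Slice := ⟨i, .wen⟩

/-- A local maximum whose legs become the strands `i` and `i + 1`. -/
abbrev cap (i : ℕ) (d : Dir) : Slice := ⟨i, .cap d⟩

/-- A local minimum that joins the strands `i` and `i + 1`. -/
abbrev cup (i : ℕ) : Slice := ⟨i, .cup⟩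

/-! ### Isotopies of the plane -/

/-- Two elementary diagrams that lie side by side exchange their heights. -/
inductive Exchange : Word → Word → Prop
  | mk (e f : Elem) (i m : ℕ) :
      Exchange [⟨i, e⟩, ⟨i + e.out + m, f⟩] [⟨i + e.inp + m, f⟩, ⟨i, e⟩]

/-- The remaining events in an isotopy of a diagram, generic with respect to the height:
birth or death of a maximum and a minimum on a strand, a maximum or a minimum of one branch of the
diagram that moves through a double point (by which the double point changes from one leg to the
other), and a wen mark that moves through a maximum or a minimum. -/
inductive Turn : Word → Word → Prop
  | zigzag_left (i : ℕ) (d : Dir) : Turn [cap i d, cup (i + 1)] []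
  | zigzag_right (i : ℕ) (d : Dir) : Turn [cap (i + 1) d, cup i] []
  | cap_cross (i : ℕ) (d : Dir) (k : Crossing) :
      Turn [cap i d, cr k (i + 1)] [cap (i + 1) d, cr k.mirror i]
  | cup_cross (i : ℕ) (k : Crossing) :
      Turn [cr k i, cup (i + 1)] [cr k.mirror (i + 1), cup i]
  | cap_wen (i : ℕ) (d : Dir) : Turn [cap i d, tau i] [cap i d, tau (i + 1)]
  | cup_wen (i : ℕ) : Turn [tau i, cup i] [tau (i + 1), cup i]

/-! ### Reidemeister moves

The words are unoriented pictures of the moves, so that in a link diagram each of the strands may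
have either orientation. -/

/-- The braid-like classical, virtual, mixed, welded and extended Reidemeister moves. -/
inductive BraidMove : Word → Word → Prop
  | R2 (i : ℕ) : BraidMove [sig i, sigInv i] []
  | R2' (i : ℕ) : BraidMove [sigInv i, sig i] []
  | R3 (i : ℕ) : BraidMove [sig i, sig (i + 1), sig i] [sig (i + 1), sig i, sig (i + 1)]
  | V2 (i : ℕ) : BraidMove [rho i, rho i] []
  | V3 (i : ℕ) : BraidMove [rho i, rho (i + 1), rho i] [rho (i + 1), rho i, rho (i + 1)]
  | M (i : ℕ) : BraidMove [rho (i + 1), rho i, sig (i + 1)] [sig i, rho (i + 1), rho i]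
  | F1 (i : ℕ) : BraidMove [sig (i + 1), sig i, rho (i + 1)] [rho i, sig (i + 1), sig i]
  | T1 (i : ℕ) : BraidMove [tau i, tau i] []
  | T2 (i : ℕ) : BraidMove [tau i, rho i] [rho i, tau (i + 1)]
  | T3 (i : ℕ) : BraidMove [tau i, sig i] [sig i, tau (i + 1)]
  | T4 (i : ℕ) : BraidMove [tau (i + 1), sig i] [rho i, sigInv i, rho i, tau i]

/-- The first Reidemeister moves `(R1)` (if `k` is classical) and `(V1)` (if `k` is welded), which
remove a kink to the right or to the left of a strand. -/
inductive KinkMove : Word → Word → Prop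
  | right (i : ℕ) (d : Dir) (k : Crossing) : KinkMove [cap (i + 1) d, cr k i, cup (i + 1)] []
  | left (i : ℕ) (d : Dir) (k : Crossing) : KinkMove [cap i d, cr k (i + 1), cup i] []

/-- `Local R w w'`: the word `w'` is obtained from `w` by replacing a part of it according to the
rule `R`. -/
def Local (R : Word → Word → Prop) (w w' : Word) : Prop :=
  ∃ a u v b : Word, R u v ∧ w = a ++ u ++ b ∧ w' = a ++ v ++ b

/-! ### Link diagrams -/

/-- A diagram of oriented closed curves in the plane with decorated double points and wen marks
(without a condition on the number of wen marks). -/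
structure ClosedDiagram where
  word : Word
  closed : Run word [] []

/-- One move: a generating step of an isotopy of the plane, or a Reidemeister move. -/
def ClosedDiagram.Move (D E : ClosedDiagram) : Prop :=
  Local (fun u v => Exchange u v ∨ Turn u v ∨ BraidMove u v ∨ KinkMove u v) D.word E.word

/-- Generalized Reidemeister equivalence: isotopy of the plane and the Reidemeister moves. Since no
move changes the parity of the number of wen marks on a component, a sequence of moves that starts
at a diagram with an even number of wen marks on each component stays among such diagrams. -/
def ClosedDiagram.Equivalent : ClosedDiagram → ClosedDiagram → Prop :=
  Relation.EqvGen ClosedDiagram.Move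

/-- The points in which the strands of a word of slices meet the horizontal lines are written
`(k, p)`: the strand `p` on the line between the slices `k - 1` and `k`. `Joined w P Q` says that
the points `P` and `Q` are joined by a piece of a strand inside a single slice. (Positions to the
right of the last strand of a line are joined to such positions only.) -/
inductive Joined (w : Word) : ℕ × ℕ → ℕ × ℕ → Prop
  | beside_left {k : ℕ} {s : Slice} (h : w[k]? = some s) {p : ℕ} (hp : p < s.pos) :
      Joined w (k, p) (k + 1, p)
  | beside_right {k : ℕ} {s : Slice} (h : w[k]? = some s) (p : ℕ) :
      Joined w (k, s.pos + s.elem.inp + p) (k + 1, s.pos + s.elem.out + p)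
  | cross_left {k i : ℕ} {c : Crossing} (h : w[k]? = some (cr c i)) :
      Joined w (k, i) (k + 1, i + 1)
  | cross_right {k i : ℕ} {c : Crossing} (h : w[k]? = some (cr c i)) :
      Joined w (k, i + 1) (k + 1, i)
  | wen {k i : ℕ} (h : w[k]? = some (tau i)) : Joined w (k, i) (k + 1, i)
  | cap {k i : ℕ} {d : Dir} (h : w[k]? = some (cap i d)) : Joined w (k + 1, i) (k + 1, i + 1)
  | cup {k i : ℕ} (h : w[k]? = some (cup i)) : Joined w (k, i) (k, i + 1)

/-- The points `P` and `Q` lie on the same component. -/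
def SameComponent (w : Word) : ℕ × ℕ → ℕ × ℕ → Prop :=
  Relation.EqvGen (Joined w)

/-- Each component (the component of each point `P`) carries an even number of wen marks. -/
def EvenWens (w : Word) : Prop :=
  ∀ P : ℕ × ℕ, Even (Set.ncard {k : ℕ | ∃ i, w[k]? = some (tau i) ∧ SameComponent w P (k, i)})

/-- Extended welded link diagrams. -/
structure LinkDiagram extends ClosedDiagram where
  even_wens : EvenWens word

/-- Generalized Reidemeister equivalence of extended welded link diagrams. -/
instance LinkDiagram.setoid : Setoid LinkDiagram where
  r D E := ClosedDiagram.Equivalent D.toClosedDiagram E.toClosedDiagram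
  iseqv :=
    { refl := fun _ => Relation.EqvGen.refl _
      symm := fun h => Relation.EqvGen.symm _ _ h
      trans := fun h h' => Relation.EqvGen.trans _ _ _ h h' }

/-- Extended welded links. -/
def Link : Type := Quotient LinkDiagram.setoid

/-- The extended welded link represented by a diagram. -/
def LinkDiagram.toLink (D : LinkDiagram) : Link := Quotient.mk LinkDiagram.setoid D

/-! ### Braid diagrams -/

/-- The slices of a braid diagram on `n` strands: crossings and wen marks. -/
inductive IsBraidSlice (n : ℕ) : Slice → Prop
  | cross (k : Crossing) (i : ℕ) (h : i + 2 ≤ n) : IsBraidSlice n (cr k i)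
  | wen (i : ℕ) (h : i + 1 ≤ n) : IsBraidSlice n (tau i)

/-- Extended welded braid diagrams on `n` strands, all of which run downwards. -/
structure BraidDiagram (n : ℕ) where
  word : Word
  isBraid : ∀ s ∈ word, IsBraidSlice n s

/-- One move of braid diagrams: a generating step of an isotopy through braid diagrams, or a
Reidemeister move. -/
def BraidDiagram.Move {n : ℕ} (b c : BraidDiagram n) : Prop :=
  Local (fun u v => Exchange u v ∨ BraidMove u v) b.word c.word

/-- Braid generalized Reidemeister equivalence. -/
def BraidDiagram.Equivalent {n : ℕ} : BraidDiagram n → BraidDiagram n → Prop :=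
  Relation.EqvGen BraidDiagram.Move

/-- A (non-extended) welded braid diagram is one without wen marks. -/
def BraidDiagram.IsWelded {n : ℕ} (b : BraidDiagram n) : Prop :=
  ∀ s ∈ b.word, s.elem ≠ Elem.wen

/-- The `n` nested maxima at the top of the closure of a braid diagram. -/
def closureTop (n : ℕ) : Word := (List.range n).map fun i => cap i .down

/-- The `n` nested minima at the bottom of the closure of a braid diagram. -/
def closureBottom (n : ℕ) : Word := (List.range n).reverse.map cup

theorem Run.append {w w' : Word} {L M N : List Dir} (h : Run w L M) (h' : Run w' M N) :
    Run (w ++ w') L N := by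
  induction h with
  | nil L => exact h'
  | cons hs _ ih => exact Run.cons hs (ih h')

/-- The directions along the horizontal lines through a braid inside its closure. -/
def closureLevel (n : ℕ) : List Dir := List.replicate n .down ++ List.replicate n .up

theorem run_closureTop (n : ℕ) : Run (closureTop n) [] (closureLevel n) := by
  induction n with
  | zero => exact Run.nil _
  | succ n ih =>
    have e : closureTop (n + 1) = closureTop n ++ [cap n .down] := by
      simp [closureTop, List.range_succ]
    rw [e]
    refine ih.append (Run.cons (M := closureLevel (n + 1)) ?_ (Run.nil _))
    refine ⟨List.replicate n .down, [], [.down, .up], List.replicate n .up, by simp,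
      Elem.Fits.cap .down, by simp [closureLevel], ?_⟩
    rw [closureLevel, List.replicate_succ', List.replicate_succ]
    simp

theorem run_closureBottom (n : ℕ) : Run (closureBottom n) (closureLevel n) [] := by
  induction n with
  | zero => exact Run.nil _
  | succ n ih =>
    have e : closureBottom (n + 1) = cup n :: closureBottom n := by
      simp [closureBottom, List.range_succ]
    rw [e]
    refine Run.cons (M := closureLevel n) ?_ ih
    refine ⟨List.replicate n .down, [.down, .up], [], List.replicate n .up, by simp,
      Elem.Fits.cup .down, ?_, by simp [closureLevel]⟩
    rw [closureLevel, List.replicate_succ', List.replicate_succ]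
    simp

theorem IsBraidSlice.step {n : ℕ} {s : Slice} (h : IsBraidSlice n s) :
    s.Step (closureLevel n) (closureLevel n) := by
  cases h with
  | cross k i h =>
    obtain ⟨m, rfl⟩ := Nat.exists_eq_add_of_le h
    refine ⟨List.replicate i .down, [.down, .down], [.down, .down],
      List.replicate m .down ++ List.replicate (i + 2 + m) .up, by simp,
      Elem.Fits.cross k .down .down, ?_, ?_⟩ <;>
    simp [closureLevel, List.replicate_add]
  | wen i h =>
    obtain ⟨m, rfl⟩ := Nat.exists_eq_add_of_le h
    refine ⟨List.replicate i .down, [.down], [.down],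
      List.replicate m .down ++ List.replicate (i + 1 + m) .up, by simp,
      Elem.Fits.wen .down, ?_, ?_⟩ <;>
    simp [closureLevel, List.replicate_add]

theorem run_braid {n : ℕ} : ∀ w : Word, (∀ s ∈ w, IsBraidSlice n s) →
    Run w (closureLevel n) (closureLevel n)
  | [], _ => Run.nil _
  | s :: w, h => Run.cons (h s (by simp)).step (run_braid w fun t ht => h t (by simp [ht]))

/-- The closed curves obtained from a braid diagram on `n` strands by joining, for each `i < n`, its
`i`-th top point with its `i`-th bottom point by an arc to the right of the braid, these `n` arcs
being nested and free of double points. -/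
def BraidDiagram.closed {n : ℕ} (b : BraidDiagram n) : ClosedDiagram where
  word := closureTop n ++ b.word ++ closureBottom n
  closed := ((run_closureTop n).append (run_braid b.word b.isBraid)).append (run_closureBottom n)

/-- A braid diagram can be closed to an extended welded link diagram if each component of the
resulting closed curves carries an even number of wen marks. -/
def BraidDiagram.Closable {n : ℕ} (b : BraidDiagram n) : Prop :=
  EvenWens b.closed.word

/-- The closure of an extended welded braid diagram. -/
def BraidDiagram.closure {n : ℕ} (b : BraidDiagram n) (h : b.Closable) : LinkDiagram where
  toClosedDiagram := b.closed
  even_wens := h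

end ExtWelded

/-! The braid can be chosen without any wen marks, so it serves as its own welded representative.
Two facts give this.

Wen marks cancel (`exists_wenFree`). An even number of marks on every component means that the
strands can be labelled by two values that change exactly at the marks (`exists_labels`). Indeed, a
cycle modulo two has the same coefficient all along a component, so the cochain counting marks
vanishes on cycles and hence is a coboundary. Now put a mark on each `true` strand of a horizontal
line and sweep the line down the diagram (`exists_wens`). At a crossing the marks pass through,
possibly altering the crossing; at a maximum or minimum they appear or vanish in pairs; at a mark of
the diagram they absorb it or pick it up. The line is empty at the start and at the end, so what
remains is an equivalent diagram without marks.

Alexander's theorem (`exists_braid`). A strand whose crossings are all welded can be rerouted past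
any part without marks (`Sim.detour`). Every horizontal line can therefore be sorted, downward
strands first, by welded crossings, and the diagram conjugated into a word between sorted lines
(`conv_wenFree`, `exists_std`). Crossings that involve an upward strand are first rotated until both
strands run downwards. Such a word is made of arbitrary crossings on the left, welded crossings on
the right, and extrema in the middle. Its maxima are lifted and its minima postponed until they are
nested (`Sim.exists_closed`); the welded crossings on the right then slide around the maxima to the
left (`Sim.exists_left`), and a closed braid remains.

All manipulations take place in `Sim L`, equivalence below a line with directions `L`. It is
compatible with composition (`Sim.ctx`) and with adding a strand on the left (`Sim.sh`), so most
local statements are needed only at position zero. -/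

namespace ExtWelded

/-! ### Runs as a partial function -/

/-- The effect of an elementary diagram at the left end of a line on the directions. -/
def Elem.act : Elem → List Dir → Option (List Dir)
  | .cross _, a :: b :: L => some (b :: a :: L)
  | .wen, a :: L => some (a :: L)
  | .cap d, L => some (d :: d.flip :: L)
  | .cup, a :: b :: L => if b = a.flip then some L else none
  | _, _ => none

/-- The effect of an elementary diagram with `i` strands to its left on the directions. -/
def Elem.actAt (e : Elem) : ℕ → List Dir → Option (List Dir)
  | 0, L => e.act L
  | i + 1, x :: L => (e.actAt i L).map (x :: ·)
  | _ + 1, [] => none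

/-- The directions at the bottom of a word, given those at its top. -/
def runF : Word → List Dir → Option (List Dir)
  | [], L => some L
  | s :: w, L => (s.elem.actAt s.pos L).bind (runF w)

theorem actAt_append (e : Elem) (pre L : List Dir) :
    e.actAt pre.length (pre ++ L) = (e.act L).map (pre ++ ·) := by
  induction pre with
  | nil => cases h : e.act L <;> simp [Elem.actAt, h]
  | cons x pre ih => simp [Elem.actAt, ih, Function.comp_def]

theorem Elem.Fits.act {e : Elem} {u v : List Dir} (h : e.Fits u v) (post : List Dir) :
    e.act (u ++ post) = some (v ++ post) := by
  cases h <;> simp [Elem.act]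

theorem Elem.exists_fits {e : Elem} {L M : List Dir} (h : e.act L = some M) :
    ∃ u v post, e.Fits u v ∧ L = u ++ post ∧ M = v ++ post := by
  cases e with
  | cross k =>
    match L, h with
    | a :: b :: L, h =>
      simp only [Elem.act, Option.some.injEq] at h
      exact ⟨[a, b], [b, a], L, .cross k a b, rfl, h ▸ rfl⟩
  | wen =>
    match L, h with
    | a :: L, h =>
      simp only [Elem.act, Option.some.injEq] at h
      exact ⟨[a], [a], L, .wen a, rfl, h ▸ rfl⟩
  | cap d =>
    simp only [Elem.act, Option.some.injEq] at h
    exact ⟨[], [d, d.flip], L, .cap d, rfl, h ▸ rfl⟩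
  | cup =>
    match L, h with
    | a :: b :: L, h =>
      simp only [Elem.act, Option.ite_none_right_eq_some, Option.some.injEq] at h
      obtain ⟨rfl, rfl⟩ := h
      exact ⟨[a, a.flip], [], L, .cup a, rfl, rfl⟩

theorem actAt_eq_some {e : Elem} : ∀ {i : ℕ} {L M : List Dir}, e.actAt i L = some M →
    ∃ pre L' M', pre.length = i ∧ L = pre ++ L' ∧ M = pre ++ M' ∧ e.act L' = some M'
  | 0, L, M, h => ⟨[], L, M, rfl, rfl, rfl, h⟩
  | i + 1, x :: L, M, h => by
    simp only [Elem.actAt, Option.map_eq_some_iff] at h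
    obtain ⟨N, hN, rfl⟩ := h
    obtain ⟨pre, L', M', rfl, rfl, rfl, h⟩ := actAt_eq_some hN
    exact ⟨x :: pre, L', M', rfl, rfl, rfl, h⟩

theorem step_iff {s : Slice} {L M : List Dir} :
    s.Step L M ↔ s.elem.actAt s.pos L = some M := by
  constructor
  · rintro ⟨pre, u, v, post, hp, hf, rfl, rfl⟩
    rw [← hp, List.append_assoc, actAt_append, hf.act]
    simp
  · intro h
    obtain ⟨pre, L', M', hp, rfl, rfl, ha⟩ := actAt_eq_some h
    obtain ⟨u, v, post, hf, rfl, rfl⟩ := Elem.exists_fits ha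
    exact ⟨pre, u, v, post, hp, hf, by simp, by simp⟩

/-- Since a maximum records the direction of its left leg, the directions above a word determine
those below it. -/
theorem run_iff {w : Word} {L M : List Dir} : Run w L M ↔ runF w L = some M := by
  constructor
  · intro h
    induction h with
    | nil L => rfl
    | cons hs _ ih => simp [runF, step_iff.1 hs, ih]
  · induction w generalizing L with
    | nil =>
      intro h
      cases h
      exact Run.nil _
    | cons s w ih =>
      intro h
      simp only [runF, Option.bind_eq_some_iff] at h
      obtain ⟨N, hN, h⟩ := h
      exact Run.cons (step_iff.2 hN) (ih h)

theorem runF_append (u v : Word) (L : List Dir) :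
    runF (u ++ v) L = (runF u L).bind (runF v) := by
  induction u generalizing L with
  | nil => rfl
  | cons s u ih =>
    simp only [List.cons_append, runF, Option.bind_assoc]
    congr 1
    funext M
    exact ih M

/-- The word `w` with one more strand to its left. -/
def sh (w : Word) : Word := w.map fun s => ⟨s.pos + 1, s.elem⟩

@[simp] theorem sh_nil : sh [] = [] := rfl

@[simp] theorem sh_cons (i : ℕ) (e : Elem) (w : Word) : sh (⟨i, e⟩ :: w) = ⟨i + 1, e⟩ :: sh w := rfl

@[simp] theorem sh_append (u v : Word) : sh (u ++ v) = sh u ++ sh v := List.map_append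

theorem runF_sh_cons (w : Word) (x : Dir) (L : List Dir) :
    runF (sh w) (x :: L) = (runF w L).map (x :: ·) := by
  induction w generalizing L with
  | nil => rfl
  | cons s w ih =>
    obtain ⟨i, e⟩ := s
    simp only [sh_cons, runF, Elem.actAt]
    cases h : e.actAt i L <;> simp [ih]

theorem runF_sh_nil {w : Word} (h : w ≠ []) : runF (sh w) [] = none := by
  obtain ⟨⟨i, e⟩, w, rfl⟩ := List.exists_cons_of_ne_nil h
  rfl

/-! ### Equivalence of words below a given line -/

/-- The generating moves of the equivalence of link diagrams. -/
def Rule (u v : Word) : Prop := Exchange u v ∨ Turn u v ∨ BraidMove u v ∨ KinkMove u v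

theorem Rule.sh {u v : Word} (h : Rule u v) : Rule (sh u) (sh v) := by
  rcases h with h | h | h | h
  · refine .inl ?_
    obtain ⟨e, f, i, m⟩ := h
    have := Exchange.mk e f (i + 1) m
    simpa [show i + 1 + e.out + m = i + e.out + m + 1 by omega,
      show i + 1 + e.inp + m = i + e.inp + m + 1 by omega] using this
  · refine .inr (.inl ?_)
    cases h <;> constructor
  · refine .inr (.inr (.inl ?_))
    cases h <;> constructor
  · refine .inr (.inr (.inr ?_))
    cases h <;> constructor

/-- One move between words with the same effect on the line `L`. -/
def MoveAt (L : List Dir) (u v : Word) : Prop :=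
  runF u L = runF v L ∧ (runF u L = none ∨ Local Rule u v)

/-- The words `u` and `v` are equivalent diagrams below the line `L`. (Words that are not diagrams
below `L` are all equivalent.) -/
def Sim (L : List Dir) : Word → Word → Prop := Relation.EqvGen (MoveAt L)

namespace Sim

variable {L : List Dir} {u v w : Word}

@[refl] theorem refl (L : List Dir) (u : Word) : Sim L u u := Relation.EqvGen.refl _

theorem symm (h : Sim L u v) : Sim L v u := Relation.EqvGen.symm _ _ h

theorem trans (h : Sim L u v) (h' : Sim L v w) : Sim L u w := Relation.EqvGen.trans _ _ _ h h'

instance : Trans (Sim L) (Sim L) (Sim L) := ⟨trans⟩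

theorem of_none (hu : runF u L = none) (hv : runF v L = none) : Sim L u v :=
  .rel _ _ ⟨hu.trans hv.symm, .inl hu⟩

theorem runF_eq (h : Sim L u v) : runF u L = runF v L := by
  induction h with
  | rel _ _ h => exact h.1
  | refl => rfl
  | symm _ _ _ ih => exact ih.symm
  | trans _ _ _ _ _ ih ih' => exact ih.trans ih'

theorem of_rule (h : Rule u v) (hr : runF u L = runF v L) : Sim L u v :=
  .rel _ _ ⟨hr, .inr ⟨[], u, v, [], h, by simp, by simp⟩⟩

theorem exchange (h : Exchange u v) (hr : runF u L = runF v L) : Sim L u v := of_rule (.inl h) hr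

theorem turn (h : Turn u v) (hr : runF u L = runF v L) : Sim L u v := of_rule (.inr (.inl h)) hr

theorem braid (h : BraidMove u v) (hr : runF u L = runF v L) : Sim L u v :=
  of_rule (.inr (.inr (.inl h))) hr

/-- The replacement only has to be valid below the line that `a` produces. If `a` does not fit below
`L`, both sides fail to be diagrams and are equivalent by convention. -/
theorem ctx (a b : Word) (h : ∀ M, runF a L = some M → Sim M u v) :
    Sim L (a ++ u ++ b) (a ++ v ++ b) := by
  cases ha : runF a L with
  | none => exact of_none (by simp [runF_append, ha]) (by simp [runF_append, ha])
  | some M =>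
    replace h := h M ha
    induction h with
    | rel u v h =>
      refine .rel _ _ ⟨by simp [runF_append, ha, h.1], ?_⟩
      rcases h.2 with hn | ⟨a', u', v', b', hR, rfl, rfl⟩
      · exact .inl (by simp [runF_append, ha, hn])
      · exact .inr ⟨a ++ a', u', v', b' ++ b, hR, by simp, by simp⟩
    | refl u => exact refl _ _
    | symm _ _ _ ih => exact ih.symm
    | trans _ _ _ _ _ ih ih' => exact ih.trans ih'

theorem left (a : Word) (h : ∀ M, runF a L = some M → Sim M u v) : Sim L (a ++ u) (a ++ v) := by
  simpa using ctx a [] h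

theorem right (b : Word) (h : Sim L u v) : Sim L (u ++ b) (v ++ b) := by
  simpa using ctx [] b (L := L) (u := u) (v := v) (by rintro M ⟨⟩; exact h)

theorem cons (s : Slice) (h : ∀ M, runF [s] L = some M → Sim M u v) :
    Sim L (s :: u) (s :: v) := left [s] h

theorem sh (h : Sim L u v) (x : Dir) : Sim (x :: L) (sh u) (sh v) := by
  induction h with
  | rel u v h =>
    refine .rel _ _ ⟨by simp [runF_sh_cons, h.1], ?_⟩
    rcases h.2 with hn | ⟨a', u', v', b', hR, rfl, rfl⟩
    · exact .inl (by simp [runF_sh_cons, hn])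
    · exact .inr ⟨ExtWelded.sh a', _, _, ExtWelded.sh b', hR.sh, by simp, by simp⟩
  | refl u => exact refl _ _
  | symm _ _ _ ih => exact ih.symm
  | trans _ _ _ _ _ ih ih' => exact ih.trans ih'

/-- Used to reduce slices at position `i` to position zero. Nonemptiness matters on the empty line,
where a shifted nonempty word does not fit but the empty word does. -/
theorem sh_all (h : ∀ L, Sim L u v) (hu : u ≠ []) (hv : v ≠ []) (L : List Dir) :
    Sim L (ExtWelded.sh u) (ExtWelded.sh v) := by
  cases L with
  | nil => exact of_none (runF_sh_nil hu) (runF_sh_nil hv)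
  | cons x L => exact (h L).sh x

end Sim

theorem Sim.equivalent {D E : ClosedDiagram} (h : Sim [] D.word E.word) : D.Equivalent E := by
  obtain ⟨u, hu⟩ := D
  obtain ⟨v, hv⟩ := E
  simp only at h
  induction h with
  | rel u v h =>
    refine .rel _ _ ?_
    rcases h.2 with hn | h
    · rw [run_iff.1 hu] at hn
      cases hn
    · exact h
  | refl => exact .refl _
  | symm _ _ _ ih => exact .symm _ _ (ih hv hu)
  | trans u v w h h' ih ih' =>
    -- Moves preserve the effect on the top line, so the intermediate word is again a closed
    -- diagram.
    have : Run v [] [] := run_iff.2 (Sim.runF_eq h ▸ run_iff.1 hu)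
    exact .trans _ _ _ (ih hu this) (ih' this hv)

/-! ### Elementary equivalences -/

theorem runF_exchange (e f : Elem) (i m : ℕ) (L : List Dir) :
    runF [⟨i, e⟩, ⟨i + e.out + m, f⟩] L = runF [⟨i + e.inp + m, f⟩, ⟨i, e⟩] L := by
  induction i generalizing L with
  | zero =>
    simp only [runF, Elem.actAt]
    cases e with
    | cross k =>
      match L with
      | [] => simp [Elem.act, Elem.inp, Elem.actAt, show 0 + 2 + m = m + 1 + 1 by omega]
      | [a] => simp [Elem.act, Elem.inp, Elem.actAt, show 0 + 2 + m = m + 1 + 1 by omega]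
      | a :: b :: L =>
        simp only [Elem.act, Elem.inp, Elem.out, Elem.actAt, show 0 + 2 + m = m + 1 + 1 by omega]
        cases h : f.actAt m L <;> simp [Elem.actAt, h]
    | wen =>
      match L with
      | [] => simp [Elem.act, Elem.inp, Elem.actAt, show 0 + 1 + m = m + 1 by omega]
      | a :: L =>
        simp only [Elem.act, Elem.inp, Elem.out, Elem.actAt, show 0 + 1 + m = m + 1 by omega]
        cases h : f.actAt m L <;> simp [Elem.actAt, h]
    | cap d =>
      simp only [Elem.act, Elem.inp, Elem.out, show 0 + 2 + m = m + 1 + 1 by omega,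
        show 0 + 0 + m = m by omega]
      cases h : f.actAt m L <;> simp [Elem.actAt, h]
    | cup =>
      match L with
      | [] => simp [Elem.act, Elem.inp, Elem.actAt, show 0 + 2 + m = m + 1 + 1 by omega]
      | [a] => simp [Elem.act, Elem.inp, Elem.actAt, show 0 + 2 + m = m + 1 + 1 by omega]
      | a :: b :: L =>
        simp only [Elem.act, Elem.inp, Elem.out, Elem.actAt, show 0 + 2 + m = m + 1 + 1 by omega,
          show 0 + 0 + m = m by omega]
        cases h : f.actAt m L <;> split_ifs <;> simp_all
  | succ i ih =>
    rw [show i + 1 + e.out + m = i + e.out + m + 1 by omega,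
      show i + 1 + e.inp + m = i + e.inp + m + 1 by omega]
    change runF (sh [⟨i, e⟩, ⟨i + e.out + m, f⟩]) L = runF (sh [⟨i + e.inp + m, f⟩, ⟨i, e⟩]) L
    cases L with
    | nil => rfl
    | cons x L => rw [runF_sh_cons, runF_sh_cons, ih]

namespace Sim

theorem exch (e f : Elem) {i j j' : ℕ} (m : ℕ) (L : List Dir) (hj : j = i + e.out + m := by simp [Elem.out])
    (hj' : j' = i + e.inp + m := by simp [Elem.inp]) :
    Sim L [⟨i, e⟩, ⟨j, f⟩] [⟨j', f⟩, ⟨i, e⟩] := by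
  subst hj hj'
  exact exchange (.mk e f i m) (runF_exchange e f i m L)

theorem cap_cross (i : ℕ) (d : Dir) (k : Crossing) (L : List Dir) :
    Sim L [cap i d, cr k (i + 1)] [cap (i + 1) d, cr k.mirror i] := by
  induction i generalizing L with
  | zero =>
    cases L with
    | nil => exact of_none rfl rfl
    | cons x L => exact turn (.cap_cross 0 d k) rfl
  | succ i ih => exact sh_all ih (by simp) (by simp) L

theorem cup_cross (i : ℕ) (k : Crossing) (L : List Dir) :
    Sim L [cr k i, cup (i + 1)] [cr k.mirror (i + 1), cup i] := by
  induction i generalizing L with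
  | zero =>
    refine turn (.cup_cross 0 k) ?_
    match L with
    | [] => rfl
    | [_] => rfl
    | [_, _] => rfl
    | x :: y :: z :: L =>
      simp only [runF, Elem.actAt, Elem.act, Option.bind_some, Option.map_some, zero_add]
      cases x <;> cases y <;> cases z <;> simp [Dir.flip]
  | succ i ih => exact sh_all ih (by simp) (by simp) L

theorem zigzag_left (d : Dir) (L : List Dir) : Sim (d :: L) [cap 0 d, cup 1] [] :=
  turn (.zigzag_left 0 d) (by cases d <;> rfl)

theorem zigzag_right (d : Dir) (L : List Dir) : Sim (d :: L) [cap 1 d.flip, cup 0] [] :=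
  turn (.zigzag_right 0 d.flip) (by cases d <;> rfl)

theorem rho_rho (x y : Dir) (L : List Dir) : Sim (x :: y :: L) [rho 0, rho 0] [] :=
  braid (.V2 0) rfl

end Sim

/-! ### Detours of welded strands, kinks at extrema, rotated crossings. -/

/-- A word without wen marks. -/
def WenFree (w : Word) : Prop := ∀ s ∈ w, s.elem ≠ Elem.wen

theorem WenFree.sh {w : Word} (h : WenFree w) : WenFree (sh w) := by
  intro s hs
  obtain ⟨t, ht, rfl⟩ := List.mem_map.1 hs
  exact h t ht

theorem WenFree.append {u v : Word} (hu : WenFree u) (hv : WenFree v) : WenFree (u ++ v) := by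
  intro s hs
  rcases List.mem_append.1 hs with h | h
  exacts [hu s h, hv s h]

/-- The word that moves the leftmost strand to the right of `n` strands, through welded
crossings. -/
def mv : ℕ → Word
  | 0 => []
  | n + 1 => rho 0 :: sh (mv n)

/-- The inverse of `mv n`. -/
def mvInv : ℕ → Word
  | 0 => []
  | n + 1 => sh (mvInv n) ++ [rho 0]

theorem runF_mv (x : Dir) (L : List Dir) : runF (mv L.length) (x :: L) = some (L ++ [x]) := by
  induction L with
  | nil => rfl
  | cons y L ih => simp [mv, runF, Elem.actAt, Elem.act, runF_sh_cons, ih]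

namespace Sim

variable {L : List Dir}

theorem mid (a b : Word) {u v : Word} (h : Rule u v)
    (hr : runF (a ++ u ++ b) L = runF (a ++ v ++ b) L) : Sim L (a ++ u ++ b) (a ++ v ++ b) :=
  .rel _ _ ⟨hr, .inr ⟨a, u, v, b, h, rfl, rfl⟩⟩

theorem braid_mid (a b : Word) {u v : Word} (h : BraidMove u v)
    (hr : runF (a ++ u ++ b) L = runF (a ++ v ++ b) L) : Sim L (a ++ u ++ b) (a ++ v ++ b) :=
  mid a b (.inr (.inr (.inl h))) hr

/-- The doubly shifted word avoids the two leftmost strands, so its slices pass the crossing one at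
a time by height exchanges. In the analogues for a maximum and a minimum, the word is renumbered by
two as it passes. -/
theorem comm_cross (k : Crossing) (w : Word) (L : List Dir) :
    Sim L (cr k 0 :: ExtWelded.sh (ExtWelded.sh w)) (ExtWelded.sh (ExtWelded.sh w) ++ [cr k 0]) := by
  induction w generalizing L with
  | nil => rfl
  | cons s w ih =>
    obtain ⟨p, f⟩ := s
    refine trans (right (ExtWelded.sh (ExtWelded.sh w)) (exch (.cross k) f (i := 0) p L ?_ ?_))
      (cons _ fun M _ => ih M) <;> simp [Elem.inp, Elem.out] <;> omega

theorem comm_wen (w : Word) (L : List Dir) :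
    Sim L (tau 0 :: ExtWelded.sh w) (ExtWelded.sh w ++ [tau 0]) := by
  induction w generalizing L with
  | nil => rfl
  | cons s w ih =>
    obtain ⟨p, f⟩ := s
    refine trans (right (ExtWelded.sh w) (exch .wen f (i := 0) p L ?_ ?_))
      (cons _ fun M _ => ih M) <;> simp [Elem.inp, Elem.out] <;> omega

theorem comm_cap (d : Dir) (w : Word) (L : List Dir) :
    Sim L (cap 0 d :: ExtWelded.sh (ExtWelded.sh w)) (w ++ [cap 0 d]) := by
  induction w generalizing L with
  | nil => rfl
  | cons s w ih =>
    obtain ⟨p, f⟩ := s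
    refine trans (right (ExtWelded.sh (ExtWelded.sh w)) (exch (.cap d) f (i := 0) (j' := p) p L ?_ ?_))
      (cons _ fun M _ => ih M) <;> simp [Elem.inp, Elem.out] <;> omega

theorem comm_cup (w : Word) (L : List Dir) :
    Sim L (cup 0 :: w) (ExtWelded.sh (ExtWelded.sh w) ++ [cup 0]) := by
  induction w generalizing L with
  | nil => rfl
  | cons s w ih =>
    obtain ⟨p, f⟩ := s
    refine trans (right w (exch .cup f (i := 0) (j := p) (j' := p + 1 + 1) p L ?_ ?_))
      (cons _ fun M _ => ih M) <;> simp [Elem.inp, Elem.out] <;> omega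

/-- The mixed move slides a crossing past a welded strand going the other way. Surrounding it with
cancelling welded pairs reverses the direction; the opposite classical crossing follows by inverting
the relation. -/
theorem slide_cross (k : Crossing) (x y z : Dir) (L : List Dir) :
    Sim (x :: y :: z :: L) [rho 0, rho 1, cr k 0] [cr k 1, rho 0, rho 1] := by
  have hs : ∀ x y z : Dir, ∀ L, Sim (x :: y :: z :: L) [rho 0, rho 1, sig 0] [sig 1, rho 0, rho 1] := by
    intro x y z L
    calc Sim (x :: y :: z :: L) [rho 0, rho 1, sig 0] [rho 0, rho 1, sig 0, rho 1, rho 1] :=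
          (braid_mid [rho 0, rho 1, sig 0] [] (.V2 1) rfl).symm
      Sim (x :: y :: z :: L) _ [rho 0, rho 1, sig 0, rho 1, rho 0, rho 0, rho 1] :=
          (braid_mid [rho 0, rho 1, sig 0, rho 1] [rho 1] (.V2 0) rfl).symm
      Sim (x :: y :: z :: L) _ [rho 0, rho 1, rho 1, rho 0, sig 1, rho 0, rho 1] :=
          (braid_mid [rho 0, rho 1] [rho 0, rho 1] (.M 0) rfl).symm
      Sim (x :: y :: z :: L) _ [rho 0, rho 0, sig 1, rho 0, rho 1] :=
          (braid_mid [rho 0] [rho 0, sig 1, rho 0, rho 1] (.V2 1) rfl)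
      Sim (x :: y :: z :: L) _ [sig 1, rho 0, rho 1] := (braid_mid [] [sig 1, rho 0, rho 1] (.V2 0) rfl)
  cases k with
  | overRight => exact hs x y z L
  | welded => exact braid (.V3 0) rfl
  | overLeft =>
    calc Sim (x :: y :: z :: L) [rho 0, rho 1, sigInv 0] [sigInv 1, sig 1, rho 0, rho 1, sigInv 0] :=
          (braid_mid [] [rho 0, rho 1, sigInv 0] (.R2' 1) rfl).symm
      Sim (x :: y :: z :: L) _ [sigInv 1, rho 0, rho 1, sig 0, sigInv 0] :=
          ctx [sigInv 1] [sigInv 0] (u := [sig 1, rho 0, rho 1]) (v := [rho 0, rho 1, sig 0]) (by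
            rintro M ⟨⟩; exact (hs _ _ _ _).symm)
      Sim (x :: y :: z :: L) _ [sigInv 1, rho 0, rho 1] := braid_mid [sigInv 1, rho 0, rho 1] [] (.R2 0) rfl

theorem slide_cap (d x : Dir) (L : List Dir) :
    Sim (x :: L) [cap 1 d, rho 0, rho 1] [cap 0 d] :=
  calc Sim (x :: L) [cap 1 d, rho 0, rho 1] [cap 0 d, rho 1, rho 1] :=
        right [rho 1] (cap_cross 0 d .welded _).symm
    Sim (x :: L) _ [cap 0 d] := left [cap 0 d] (by rintro M ⟨⟩; exact (rho_rho _ _ _).sh _)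

theorem slide_cup (x y z : Dir) (L : List Dir) :
    Sim (x :: y :: z :: L) [rho 0, rho 1, cup 0] [cup 1] :=
  calc Sim (x :: y :: z :: L) [rho 0, rho 1, cup 0] [rho 0, rho 0, cup 1] :=
        left [rho 0] (by rintro M -; exact (cup_cross 0 .welded _).symm)
    Sim (x :: y :: z :: L) _ [cup 1] := right [cup 1] (rho_rho _ _ _)

/-- A strand whose crossings are all welded moves across an elementary diagram. -/
theorem detour_slice {s : Slice} (hs : s.elem ≠ .wen) (x : Dir) {L M : List Dir}
    (h : runF [s] L = some M) :
    Sim (x :: L) (mv L.length ++ [s]) (ExtWelded.sh [s] ++ mv M.length) := by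
  obtain ⟨p, e⟩ := s
  replace hs : e ≠ .wen := hs
  induction p generalizing x L M with
  | zero =>
    cases e with
    | wen => exact absurd rfl hs
    | cross k =>
      match L, h with
      | a :: b :: L, h =>
        cases h
        have h1 := cons (L := x :: a :: b :: L) (rho 0) fun M _ =>
          cons (L := M) (rho 1) fun M _ => (comm_cross k (mv L.length) M).symm
        have h2 := right (ExtWelded.sh (ExtWelded.sh (mv L.length))) (slide_cross k x a b L)
        exact h1.trans h2
    | cap d =>
      cases h
      exact (comm_cap d (mv L.length) _).symm.trans (right _ (slide_cap d x L).symm)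
    | cup =>
      match L, h with
      | a :: b :: L, h =>
        simp only [runF, Elem.actAt, Elem.act, Option.bind_fun_some,
          Option.ite_none_right_eq_some, Option.some.injEq] at h
        obtain ⟨rfl, rfl⟩ := h
        have h1 := cons (L := x :: a :: a.flip :: L) (rho 0) fun M _ =>
          cons (L := M) (rho 1) fun M _ => (comm_cup (mv L.length) M).symm
        have h2 := right (mv L.length) (slide_cup x a a.flip L)
        exact h1.trans h2
  | succ p ih =>
    match L, h with
    | y :: L, h =>
      change runF (ExtWelded.sh [⟨p, e⟩]) (y :: L) = some M at h
      rw [runF_sh_cons, Option.map_eq_some_iff] at h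
      obtain ⟨N, hN, rfl⟩ := h
      have h1 : Sim (x :: y :: L) (rho 0 :: (ExtWelded.sh (mv L.length) ++ [⟨p + 1, e⟩]))
          (rho 0 :: (⟨p + 1 + 1, e⟩ :: ExtWelded.sh (mv N.length))) :=
        cons _ (by rintro _ ⟨⟩; simpa using (ih x hN).sh y)
      exact h1.trans (right (ExtWelded.sh (mv N.length)) (comm_cross .welded [⟨p, e⟩] _))

/-- Crossing everything above `w` is the same as crossing everything below it. This makes
conjugation by the sorting words possible. -/
theorem detour {w : Word} (hw : WenFree w) (x : Dir) {L M : List Dir} (h : runF w L = some M) :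
    Sim (x :: L) (mv L.length ++ w) (ExtWelded.sh w ++ mv M.length) := by
  induction w generalizing L with
  | nil =>
    cases h
    simp [refl]
  | cons s w ih =>
    simp only [runF, Option.bind_eq_some_iff] at h
    obtain ⟨N, hN, h⟩ := h
    have hs : runF [s] L = some N := by simp [runF, hN]
    have h1 : Sim (x :: L) (mv L.length ++ s :: w) (ExtWelded.sh [s] ++ (mv N.length ++ w)) := by
      simpa using right w (detour_slice (hw s (by simp)) x hs)
    refine h1.trans ?_
    rw [show ExtWelded.sh (s :: w) = ExtWelded.sh [s] ++ ExtWelded.sh w from rfl, List.append_assoc]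
    refine left _ fun K hK => ?_
    rw [runF_sh_cons, hs] at hK
    cases hK
    exact ih (fun t ht => hw t (by simp [ht])) h

/-- A welded kink at a maximum. -/
theorem cap_kink (d : Dir) (L : List Dir) : Sim L [cap 0 d, rho 0] [cap 0 d.flip] :=
  calc Sim L [cap 0 d, rho 0] [cap 0 d, rho 0, cap 2 d.flip, cup 1] :=
        -- An extra zigzag on the right leg supplies the second maximum and the minimum needed to
        -- exhibit a removable kink.
        left [cap 0 d, rho 0] (by rintro M ⟨⟩; exact ((zigzag_right d L).sh _).symm)
    Sim L _ [cap 0 d, cap 2 d.flip, rho 0, cup 1] :=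
        ctx [cap 0 d] [cup 1] (u := [rho 0, cap 2 d.flip]) (v := [cap 2 d.flip, rho 0]) (by
          rintro M ⟨⟩; exact exch (.cross .welded) (.cap d.flip) 0 _)
    Sim L _ [cap 0 d.flip, cap 0 d, rho 0, cup 1] :=
        right [rho 0, cup 1] (exch (.cap d) (.cap d.flip) (i := 0) (j := 2) 0 _)
    Sim L _ [cap 0 d.flip, cap 0 d, rho 1, cup 0] :=
        left [cap 0 d.flip, cap 0 d] (by rintro M ⟨⟩; exact cup_cross 0 .welded _)
    Sim L _ [cap 0 d.flip] :=
        mid [cap 0 d.flip] [] (.inr (.inr (.inr (.left 0 d .welded)))) (by cases d <;> rfl)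

/-- A welded kink at a minimum. -/
theorem cup_kink (d : Dir) (L : List Dir) :
    Sim (d :: d.flip :: L) [rho 0, cup 0] [cup 0] :=
  calc Sim (d :: d.flip :: L) [rho 0, cup 0] [cap 1 d.flip, cup 2, rho 0, cup 0] :=
        right [rho 0, cup 0] ((zigzag_left d.flip L).sh _).symm
    Sim (d :: d.flip :: L) _ [cap 1 d.flip, rho 0, cup 2, cup 0] :=
        ctx [cap 1 d.flip] [cup 0] (u := [cup 2, rho 0]) (v := [rho 0, cup 2]) (by
          rintro M ⟨⟩; exact (exch (.cross .welded) .cup 0 _).symm)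
    Sim (d :: d.flip :: L) _ [cap 1 d.flip, rho 0, cup 0, cup 0] :=
        left [cap 1 d.flip, rho 0] (by
          rintro M ⟨⟩; exact (exch .cup .cup (i := 0) (j := 0) (j' := 2) 0 _).symm)
    Sim (d :: d.flip :: L) _ [cap 0 d.flip, rho 1, cup 0, cup 0] :=
        right [cup 0, cup 0] (cap_cross 0 d.flip .welded _).symm
    Sim (d :: d.flip :: L) _ [cup 0] :=
        mid [] [cup 0] (.inr (.inr (.inr (.left 0 d.flip .welded)))) (by cases d <;> rfl)

/-- A quarter turn: the crossing in the middle now has the directions `y.flip`, `x` at its top. The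
rotation to the other side gives `y`, `x.flip` instead. -/
theorem rotate_left (k : Crossing) (x y : Dir) (L : List Dir) :
    Sim (x :: y :: L) [cr k 0] [cap 0 y, cr k.mirror 1, cup 2] :=
  calc Sim (x :: y :: L) [cr k 0] [cap 1 y, cup 2, cr k 0] :=
        right [cr k 0] ((zigzag_left y L).sh _).symm
    Sim (x :: y :: L) _ [cap 1 y, cr k 0, cup 2] :=
        left [cap 1 y] (by rintro M ⟨⟩; exact (exch (.cross k) .cup 0 _).symm)
    Sim (x :: y :: L) _ [cap 0 y, cr k.mirror 1, cup 2] :=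
        right [cup 2] (u := [cap 1 y, cr k 0]) (v := [cap 0 y, cr k.mirror 1])
          (by
            cases k
            exacts [(cap_cross 0 y .overLeft _).symm, (cap_cross 0 y .overRight _).symm,
              (cap_cross 0 y .welded _).symm])

theorem rotate_right (k : Crossing) (x y : Dir) (L : List Dir) :
    Sim (x :: y :: L) [cr k 0] [cap 2 x.flip, cr k.mirror 1, cup 0] :=
  calc Sim (x :: y :: L) [cr k 0] [cap 1 x.flip, cup 0, cr k 0] :=
        right [cr k 0] (zigzag_right x (y :: L)).symm
    Sim (x :: y :: L) _ [cap 1 x.flip, cr k 2, cup 0] :=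
        left [cap 1 x.flip] (by
          rintro M ⟨⟩; exact exch .cup (.cross k) (i := 0) (j := 0) (j' := 2) 0 _)
    Sim (x :: y :: L) _ [cap 2 x.flip, cr k.mirror 1, cup 0] := right [cup 0] (cap_cross 1 x.flip k _)

end Sim

@[simp] theorem Dir.flip_flip (d : Dir) : d.flip.flip = d := by cases d <;> rfl

/-! ### Sorting the strands by direction -/

/-- A line on which `a` strands that run downwards are followed by `b` strands that run upwards. -/
def sorted (a b : ℕ) : List Dir := List.replicate a .down ++ List.replicate b .up

/-- The word that sorts the strands of a line by direction, through welded crossings. -/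
def sortWord : List Dir → Word
  | [] => []
  | .down :: L => sh (sortWord L)
  | .up :: L => sh (sortWord L) ++ mv L.length

@[simp] theorem length_sorted (a b : ℕ) : (sorted a b).length = a + b := by simp [sorted]

theorem sorted_succ_left (a b : ℕ) : sorted (a + 1) b = .down :: sorted a b := by
  simp [sorted, List.replicate_succ]

theorem sorted_succ_right (a b : ℕ) : sorted a (b + 1) = sorted a b ++ [.up] := by
  simp [sorted, List.replicate_succ']

theorem count_add_count (L : List Dir) : L.count .down + L.count .up = L.length := by
  induction L with
  | nil => rfl
  | cons x L ih => cases x <;> simp <;> omega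

theorem runF_sortWord (L : List Dir) :
    runF (sortWord L) L = some (sorted (L.count .down) (L.count .up)) := by
  induction L with
  | nil => rfl
  | cons x L ih =>
    cases x with
    | down => simp [sortWord, runF_sh_cons, ih, sorted_succ_left]
    | up =>
      have := runF_mv .up (sorted (L.count .down) (L.count .up))
      rw [length_sorted, count_add_count] at this
      simp [sortWord, runF_append, runF_sh_cons, ih, this, sorted_succ_right]

/-- Words between sorted lines, made of crossings of strands that run downwards, welded crossings of
strands that run upwards, and maxima and minima between the former and the latter strands. -/
inductive Std : Word → ℕ → ℕ → ℕ → ℕ → Prop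
  | nil (a b : ℕ) : Std [] a b a b
  | down (k : Crossing) {i a b a' b' : ℕ} {w : Word} (h : i + 2 ≤ a) :
      Std w a b a' b' → Std (cr k i :: w) a b a' b'
  | up {i a b a' b' : ℕ} {w : Word} (hi : a ≤ i) (h : i + 2 ≤ a + b) :
      Std w a b a' b' → Std (rho i :: w) a b a' b'
  | cap {a b a' b' : ℕ} {w : Word} :
      Std w (a + 1) (b + 1) a' b' → Std (cap a .down :: w) a b a' b'
  | cup {a b a' b' : ℕ} {w : Word} :
      Std w a b a' b' → Std (cup a :: w) (a + 1) (b + 1) a' b'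

theorem actAt_sorted {e : Elem} {i : ℕ} {pre L M N K : List Dir} (hp : pre.length = i)
    (hN : N = pre ++ L) (h : e.act L = some M) (hK : pre ++ M = K) :
    e.actAt i N = some K := by
  subst hp hN hK
  rw [actAt_append, h]
  rfl

namespace Std

variable {w w' : Word} {a b a' b' a'' b'' : ℕ}

theorem append (h : Std w a b a' b') (h' : Std w' a' b' a'' b'') : Std (w ++ w') a b a'' b'' := by
  induction h with
  | nil => exact h'
  | down k hi _ ih => exact .down k hi (ih h')
  | up hi hi' _ ih => exact .up hi hi' (ih h')
  | cap _ ih => exact .cap (ih h')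
  | cup _ ih => exact .cup (ih h')

theorem single_down (k : Crossing) {i : ℕ} (h : i + 2 ≤ a) : Std [cr k i] a b a b :=
  .down k h (.nil _ _)

theorem sh (h : Std w a b a' b') : Std (sh w) (a + 1) b (a' + 1) b' := by
  induction h with
  | nil => exact .nil _ _
  | @down k i a b a' b' w hi _ ih => exact .down k (show i + 1 + 2 ≤ a + 1 by omega) ih
  | @up i a b a' b' w hi hi' _ ih =>
    exact .up (show a + 1 ≤ i + 1 by omega) (show i + 1 + 2 ≤ a + 1 + b by omega) ih
  | cap _ ih => exact .cap ih
  | cup _ ih => exact .cup ih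

theorem right (h : Std w a b a' b') : Std w a (b + 1) a' (b' + 1) := by
  induction h with
  | nil => exact .nil _ _
  | down k hi _ ih => exact .down k hi ih
  | up hi hi' _ ih => exact .up hi (by omega) ih
  | cap _ ih => exact .cap ih
  | cup _ ih => exact .cup ih

theorem wenFree (h : Std w a b a' b') : WenFree w := by
  induction h with
  | nil => simp [WenFree]
  | _ => simp_all [WenFree]

theorem runF (h : Std w a b a' b') : runF w (sorted a b) = some (sorted a' b') := by
  induction h with
  | nil => rfl
  | @down k i a b a' b' w hi _ ih =>
    obtain ⟨m, rfl⟩ := Nat.exists_eq_add_of_le hi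
    rw [ExtWelded.runF, actAt_sorted (pre := List.replicate i .down)
      (L := .down :: .down :: sorted m b) (K := sorted (i + 2 + m) b) (by simp) ?_ rfl ?_]
    · simpa using ih
    · rw [sorted, List.replicate_add, List.replicate_add]
      simp [sorted, List.replicate_succ]
    · rw [sorted, sorted, List.replicate_add, List.replicate_add]
      simp [List.replicate_succ]
  | @up i a b a' b' w hi hi' _ ih =>
    obtain ⟨j, rfl⟩ := Nat.exists_eq_add_of_le hi
    obtain ⟨m, rfl⟩ := Nat.exists_eq_add_of_le (show j + 2 ≤ b by omega)
    rw [ExtWelded.runF, actAt_sorted (pre := sorted a j)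
      (L := .up :: .up :: List.replicate m .up) (K := sorted a (j + 2 + m)) (by simp) ?_ rfl ?_]
    · simpa using ih
    · rw [sorted, List.replicate_add, List.replicate_add]
      simp [sorted, List.replicate_succ]
    · rw [sorted, sorted, List.replicate_add, List.replicate_add]
      simp [List.replicate_succ]
  | @cap a b a' b' w _ ih =>
    rw [ExtWelded.runF, actAt_sorted (pre := List.replicate a .down)
      (L := List.replicate b .up) (K := sorted (a + 1) (b + 1)) (by simp) ?_ rfl ?_]
    · simpa using ih
    · simp [sorted]
    · rw [sorted, List.replicate_succ', List.replicate_succ]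
      simp [Dir.flip]
  | @cup a b a' b' w _ ih =>
    rw [ExtWelded.runF, actAt_sorted (pre := List.replicate a .down)
      (L := .down :: .up :: List.replicate b .up) (K := sorted a b) (by simp) ?_ rfl ?_]
    · simpa using ih
    · rw [sorted, List.replicate_succ', List.replicate_succ]
      simp
    · simp [sorted]

end Std

/-! ### Conjugation into words between sorted lines -/

/-- Conjugation with the sorting words turns the diagram `w` below `L` into a word between sorted
lines. -/
def Conv (L : List Dir) (w : Word) : Prop :=
  ∀ M, runF w L = some M → ∃ v, Std v (L.count .down) (L.count .up) (M.count .down) (M.count .up) ∧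
    Sim L (w ++ sortWord M) (sortWord L ++ v)

namespace Conv

variable {L : List Dir} {u v w : Word}

theorem nil (L : List Dir) : Conv L [] := by
  rintro M ⟨⟩
  exact ⟨[], .nil _ _, by simp [Sim.refl]⟩

theorem append (hu : Conv L u) (hv : ∀ M, runF u L = some M → Conv M v) : Conv L (u ++ v) := by
  intro N hN
  rw [runF_append, Option.bind_eq_some_iff] at hN
  obtain ⟨M, hM, hN⟩ := hN
  obtain ⟨u', hu', hus⟩ := hu M hM
  obtain ⟨v', hv', hvs⟩ := hv M hM N hN
  refine ⟨u' ++ v', hu'.append hv', ?_⟩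
  have h1 : Sim L (u ++ (v ++ sortWord N)) (u ++ (sortWord M ++ v')) :=
    Sim.left u fun K hK => by
      rw [hM] at hK
      cases hK
      exact hvs
  simpa using h1.trans (by simpa using hus.right v')

theorem of_sim (h : Sim L u v) (hv : Conv L v) : Conv L u := by
  intro M hM
  obtain ⟨w, hw, hs⟩ := hv M (h.runF_eq ▸ hM)
  exact ⟨w, hw, (h.right _).trans hs⟩

/-- A new downward strand stays on the left of the sorted word. A new upward strand is sorted to the
far right by welded crossings, and the detour move carries it across `v`, which is left unchanged.
-/
theorem sh (hw : Conv L w) (x : Dir) : Conv (x :: L) (sh w) := by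
  intro M hM
  rw [runF_sh_cons, Option.map_eq_some_iff] at hM
  obtain ⟨M, hM, rfl⟩ := hM
  obtain ⟨v, hv, hs⟩ := hw M hM
  have hs' := hs.sh x
  simp only [sh_append] at hs'
  cases x with
  | down => exact ⟨ExtWelded.sh v, by simpa using hv.sh, by simpa [sortWord] using hs'⟩
  | up =>
    refine ⟨v, by simpa using hv.right, ?_⟩
    have h1 := hs'.right (mv M.length)
    have h2 : Sim (Dir.up :: L) (ExtWelded.sh (sortWord L) ++ (ExtWelded.sh v ++ mv M.length))
        (ExtWelded.sh (sortWord L) ++ (mv L.length ++ v)) :=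
      Sim.left _ fun K hK => by
        rw [runF_sh_cons, runF_sortWord] at hK
        cases hK
        have := Sim.detour hv.wenFree .up hv.runF
        rw [length_sorted, length_sorted, count_add_count, count_add_count] at this
        exact this.symm
    simp only [sortWord]
    refine Sim.trans (v := ExtWelded.sh (sortWord L) ++ (ExtWelded.sh v ++ mv M.length)) ?_ ?_
    · simpa using h1
    · simpa using h2

end Conv

theorem Std.of_rho {w : Word} {n : ℕ} (h : ∀ s ∈ w, ∃ i < n, s = rho i) :
    Std w 0 (n + 1) 0 (n + 1) := by
  induction w with
  | nil => exact .nil _ _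
  | cons s w ih =>
    obtain ⟨i, hi, rfl⟩ := h s (by simp)
    exact .up (by omega) (by omega) (ih fun t ht => h t (by simp [ht]))

theorem rho_of_mem_sh {w : Word} {n : ℕ} (h : ∀ s ∈ w, ∃ i < n, s = rho i) :
    ∀ s ∈ sh w, ∃ i < n + 1, s = rho i := by
  intro s hs
  obtain ⟨t, ht, rfl⟩ := List.mem_map.1 hs
  obtain ⟨i, hi, rfl⟩ := h t ht
  exact ⟨i + 1, by omega, rfl⟩

theorem rho_of_mem_mv {n : ℕ} : ∀ {s}, s ∈ mv n → ∃ i < n, s = rho i := by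
  induction n with
  | zero => simp [mv]
  | succ n ih =>
    intro s hs
    rcases List.mem_cons.1 hs with rfl | hs
    · exact ⟨0, by omega, rfl⟩
    · exact rho_of_mem_sh (fun s hs => ih hs) s hs

theorem rho_of_mem_mvInv {n : ℕ} : ∀ {s}, s ∈ mvInv n → ∃ i < n, s = rho i := by
  induction n with
  | zero => simp [mvInv]
  | succ n ih =>
    intro s hs
    rcases List.mem_append.1 hs with hs | hs
    · exact rho_of_mem_sh (fun s hs => ih hs) s hs
    · exact ⟨0, by omega, List.mem_singleton.1 hs⟩

/-- The upward leg of a maximum at the left end of a sorted line moves to the right end. -/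
theorem exists_std_cap (a b : ℕ) : ∃ v, Std v a b (a + 1) (b + 1) ∧
    Sim (sorted a b) (cap 0 .down :: sh (mv (a + b))) v := by
  induction a with
  | zero =>
    refine ⟨_, .cap (Std.sh ?_), Sim.refl _ _⟩
    simpa using Std.of_rho fun s hs => rho_of_mem_mv hs
  | succ a ih =>
    obtain ⟨v, hv, hs⟩ := ih
    refine ⟨sh v ++ [rho 0], hv.sh.append (.single_down _ (by omega)), ?_⟩
    rw [show a + 1 + b = a + b + 1 by omega, sorted_succ_left]
    -- Passing the first downward strand is traded for a crossing with the downward leg of the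
    -- maximum; that crossing is allowed in a standard word and moves to its end.
    have h1 : Sim (.down :: sorted a b) (cap 0 .down :: sh (mv (a + b + 1)))
        (cap 1 .down :: rho 0 :: sh (sh (mv (a + b)))) := (Sim.cap_cross 0 .down .welded _).right _
    have h2 : Sim (.down :: sorted a b) (cap 1 .down :: rho 0 :: sh (sh (mv (a + b))))
        (cap 1 .down :: (sh (sh (mv (a + b))) ++ [rho 0])) :=
      Sim.cons _ fun M _ => Sim.comm_cross .welded _ M
    exact (h1.trans h2).trans ((hs.sh .down).right [rho 0])

/-- Sorting the line below the maximum carries its upward leg to the far right. If the left leg runs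
upwards, sorting also crosses the two legs, and this kink is absorbed by reversing the maximum. -/
theorem conv_cap (d : Dir) (L : List Dir) : Conv L [cap 0 d] := by
  rintro M ⟨⟩
  obtain ⟨v, hv, hs⟩ := exists_std_cap (L.count .down) (L.count .up)
  rw [count_add_count] at hs
  have hd : Sim L (cap 0 .down :: (sh (sh (sortWord L)) ++ sh (mv L.length))) (sortWord L ++ v) := by
    refine ((Sim.comm_cap .down (sortWord L) L).right (sh (mv L.length))).trans ?_
    rw [List.append_assoc]
    refine Sim.left _ fun K hK => ?_
    rw [runF_sortWord] at hK
    cases hK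
    exact hs
  refine ⟨v, by cases d <;> simpa [Dir.flip] using hv, ?_⟩
  cases d with
  | down => simpa [sortWord, Dir.flip] using hd
  | up =>
    have h1 : Sim L (cap 0 .up :: (sh (sh (sortWord L)) ++ rho 0 :: sh (mv L.length)))
        (cap 0 .up :: rho 0 :: (sh (sh (sortWord L)) ++ sh (mv L.length))) :=
      Sim.cons _ fun M _ => by
        simpa using ((Sim.comm_cross .welded (sortWord L) M).symm.right (sh (mv L.length)))
    refine Sim.trans (by simpa [sortWord, Dir.flip, mv] using h1) ?_
    exact ((Sim.cap_kink .up L).right _).trans hd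

theorem Sim.mv_mvInv (n : ℕ) {L : List Dir} (h : n + 1 ≤ L.length) : Sim L (mv n ++ mvInv n) [] := by
  induction n generalizing L with
  | zero => exact refl _ _
  | succ n ih =>
    match L, h with
    | x :: y :: L, h =>
      have h1 : Sim (x :: y :: L) ([rho 0] ++ ExtWelded.sh (mv n ++ mvInv n) ++ [rho 0])
          ([rho 0] ++ [] ++ [rho 0]) :=
        ctx [rho 0] [rho 0] (by
          rintro M ⟨⟩
          exact (ih (by simpa using h)).sh _)
      simpa [mv, mvInv] using h1.trans (rho_rho x y L)

/-- Sorting the line above the minimum carries its upward leg away; `v` brings that leg back through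
the upward strands, while the downward leg travels through the downward strands to meet it. -/
theorem exists_std_cup (a b : ℕ) : ∃ v, Std v (a + 1) (b + 1) a b ∧
    Sim (.down :: .up :: sorted a b) [cup 0] (sh (mv (a + b)) ++ v) := by
  induction a with
  | zero =>
    refine ⟨sh (mvInv b) ++ [cup 0], .append ?_ (.cup (.nil _ _)), ?_⟩
    · simpa using (Std.of_rho fun s hs => rho_of_mem_mvInv hs).sh
    · have h1 := Sim.right [cup 0] ((Sim.mv_mvInv b (L := .up :: sorted 0 b) (by simp)).sh .down)
      simpa using h1.symm
  | succ a ih =>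
    obtain ⟨v, hv, hs⟩ := ih
    refine ⟨rho 0 :: sh v, .down _ (by omega) hv.sh, ?_⟩
    rw [show a + 1 + b = a + b + 1 by omega, sorted_succ_left]
    have h1 : Sim (.down :: .up :: .down :: sorted a b) [cup 0] [rho 1, rho 1, cup 0] :=
      (((Sim.rho_rho _ _ _).sh .down).right [cup 0]).symm
    have h2 : Sim (.down :: .up :: .down :: sorted a b) [rho 1, rho 1, cup 0] [rho 1, rho 0, cup 1] :=
      Sim.left [rho 1] fun M _ => (Sim.cup_cross 0 .welded _).symm
    have h3 : Sim (.down :: .up :: .down :: sorted a b) ([rho 1, rho 0] ++ [cup 1])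
        ([rho 1, rho 0] ++ sh (sh (mv (a + b)) ++ v)) :=
      Sim.left [rho 1, rho 0] (by
        rintro M ⟨⟩
        exact hs.sh .down)
    have h4 : Sim (.down :: .up :: .down :: sorted a b) ([rho 1, rho 0] ++ sh (sh (mv (a + b)) ++ v))
        (rho 1 :: (sh (sh (mv (a + b))) ++ rho 0 :: sh v)) :=
      Sim.cons _ fun M _ => by
        simpa using (Sim.comm_cross .welded (mv (a + b)) M).right (sh v)
    exact ((h1.trans h2).trans h3).trans h4


theorem conv_cup (x : Dir) (L : List Dir) : Conv (x :: x.flip :: L) [cup 0] := by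
  intro M hM
  have : M = L := by simpa [runF, Elem.actAt, Elem.act, eq_comm] using hM
  subst this
  obtain ⟨v, hv, hs⟩ := exists_std_cup (M.count .down) (M.count .up)
  rw [count_add_count] at hs
  refine ⟨v, by cases x <;> simpa [Dir.flip] using hv, ?_⟩
  have h1 : Sim (x :: x.flip :: M) ([cup 0] ++ sortWord M) (sh (sh (sortWord M)) ++ [cup 0]) :=
    Sim.comm_cup _ _
  refine h1.trans ?_
  cases x with
  | down =>
    have h2 : Sim (Dir.down :: Dir.down.flip :: M) (sh (sh (sortWord M)) ++ [cup 0])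
        (sh (sh (sortWord M)) ++ (sh (mv M.length) ++ v)) :=
      Sim.left _ fun K hK => by
        rw [runF_sh_cons, runF_sh_cons, runF_sortWord] at hK
        cases hK
        exact hs
    simpa [sortWord, Dir.flip] using h2
  | up =>
    have h2 : Sim (Dir.up :: Dir.up.flip :: M) (sh (sh (sortWord M)) ++ [cup 0])
        (sh (sh (sortWord M)) ++ (rho 0 :: (sh (mv M.length) ++ v))) :=
      Sim.left _ fun K hK => by
        rw [runF_sh_cons, runF_sh_cons, runF_sortWord] at hK
        cases hK
        refine (Sim.cup_kink .up _).symm.trans (Sim.cons _ ?_)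
        rintro K ⟨⟩
        exact hs
    simpa [sortWord, Dir.flip, mv] using h2

theorem conv_cross_down (k : Crossing) (L : List Dir) : Conv (.down :: .down :: L) [cr k 0] := by
  rintro M ⟨⟩
  exact ⟨[cr k 0], by simpa using Std.single_down _ (by omega), Sim.comm_cross k _ _⟩

theorem Conv.three {L : List Dir} {s t u : Slice} (hs : Conv L [s])
    (ht : ∀ M, runF [s] L = some M → Conv M [t]) (hu : ∀ M, runF [s, t] L = some M → Conv M [u]) :
    Conv L [s, t, u] :=
  (hs.append ht : Conv L [s, t]).append hu

/-- Extrema can already be conjugated, so a crossing may be replaced by its quarter turn, which has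
one strand reversed. -/
theorem conv_cross_left {k : Crossing} {x y : Dir} {L : List Dir}
    (h : ∀ L, Conv (y.flip :: x :: L) [cr k.mirror 0]) : Conv (x :: y :: L) [cr k 0] :=
  .of_sim (Sim.rotate_left k x y L) <| .three (conv_cap _ _)
    (by rintro M ⟨⟩; exact (h _).sh _)
    (by rintro M ⟨⟩; exact ((Dir.flip_flip y ▸ conv_cup y.flip L).sh _).sh _)

theorem conv_cross (k : Crossing) (x y : Dir) (L : List Dir) : Conv (x :: y :: L) [cr k 0] := by
  have hdu : ∀ k L, Conv (.down :: .up :: L) [cr k 0] := fun k L =>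
    conv_cross_left fun L => conv_cross_down _ L
  cases x <;> cases y
  · exact conv_cross_down k L
  · exact hdu k L
  -- Turning to the left would produce two upward strands here; turning to the right gives two
  -- downward ones at once.
  · exact .of_sim (Sim.rotate_right k .up .down L) <| .three (((conv_cap _ _).sh _).sh _)
      (by rintro M ⟨⟩; exact (conv_cross_down _ _).sh _)
      (by rintro M ⟨⟩; exact conv_cup .up _)
  · exact conv_cross_left fun L => hdu _ L

theorem conv_slice {s : Slice} (hs : s.elem ≠ .wen) (L : List Dir) : Conv L [s] := by
  obtain ⟨p, e⟩ := s
  replace hs : e ≠ .wen := hs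
  induction p generalizing L with
  | zero =>
    intro M hM
    cases e with
    | wen => exact absurd rfl hs
    | cross k =>
      match L, hM with
      | x :: y :: L, hM => exact conv_cross k x y L M hM
    | cap d => exact conv_cap d L M hM
    | cup =>
      match L, hM with
      | x :: y :: L, hM =>
        have h : y = x.flip := by
          by_contra h
          simp [runF, Elem.actAt, Elem.act, h] at hM
        subst h
        exact conv_cup x L M hM
  | succ p ih =>
    cases L with
    | nil => rintro M ⟨⟩
    | cons x L => exact (ih L).sh x

theorem conv_wenFree {w : Word} (hw : WenFree w) (L : List Dir) : Conv L w := by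
  induction w generalizing L with
  | nil => exact .nil L
  | cons s w ih =>
    exact (conv_slice (hw s (by simp)) L).append (v := w)
      fun M _ => ih (fun t ht => hw t (by simp [ht])) M

theorem exists_std {w : Word} (hw : WenFree w) (h : runF w [] = some []) :
    ∃ v, Std v 0 0 0 0 ∧ Sim [] w v := by
  obtain ⟨v, hv, hs⟩ := conv_wenFree hw [] [] h
  exact ⟨v, hv, by simpa [sortWord] using hs⟩

/-! ### Closing a word between sorted lines -/

/-- The crossings below `n` nested maxima: all crossings of the `n` strands on the left, and welded
crossings of the `n` strands on the right. -/
inductive Inner (n : ℕ) : Slice → Prop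
  | left (k : Crossing) {i : ℕ} (h : i + 2 ≤ n) : Inner n (cr k i)
  | right {i : ℕ} (hi : n ≤ i) (h : i + 2 ≤ n + n) : Inner n (rho i)

/-- The minima at the positions `a + m - 1, …, a`. -/
def cups (a : ℕ) : ℕ → Word
  | 0 => []
  | m + 1 => cup (a + m) :: cups a m

theorem cups_succ (a m : ℕ) : cups a (m + 1) = cups (a + 1) m ++ [cup a] := by
  induction m with
  | zero => rfl
  | succ m ih =>
    rw [cups, ih, cups, show a + (m + 1) = a + 1 + m by omega]
    rfl

theorem cups_zero (n : ℕ) : cups 0 n = closureBottom n := by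
  induction n with
  | zero => rfl
  | succ n ih => simp [cups, ih, closureBottom, List.range_succ]

theorem closureTop_succ (n : ℕ) : closureTop (n + 1) = closureTop n ++ [cap n .down] := by
  simp [closureTop, List.range_succ]

namespace Sim

theorem cups_left {i a : ℕ} (h : i + 2 ≤ a) (k : Crossing) (m : ℕ) (L : List Dir) :
    Sim L (cups a m ++ [cr k i]) (cr k i :: cups a m) := by
  induction m generalizing L with
  | zero => rfl
  | succ m ih =>
    refine (cons (cup (a + m)) fun M _ => ih M).trans (right (cups a m) (u := [cup (a + m), cr k i])
      (v := [cr k i, cup (a + m)]) (exch (.cross k) .cup (a + m - (i + 2)) L ?_ ?_).symm) <;>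
    simp only [Elem.inp, Elem.out] <;> omega

/-- Above the `m` minima there are `2 * m` more strands to the left of the crossing. -/
theorem cups_right {i a : ℕ} (h : a ≤ i) (k : Crossing) (m : ℕ) (L : List Dir) :
    Sim L (cups a m ++ [cr k i]) (cr k (i + 2 * m) :: cups a m) := by
  induction m generalizing i a L with
  | zero => rfl
  | succ m ih =>
    rw [cups_succ, List.append_assoc, show i + 2 * (m + 1) = i + 2 + 2 * m by ring]
    have h1 : Sim L (cups (a + 1) m ++ [cup a, cr k i]) (cups (a + 1) m ++ [cr k (i + 2), cup a]) :=
      left _ fun M _ => exch .cup (.cross k) (i - a) M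
        (by simp only [Elem.out]; omega) (by simp only [Elem.inp]; omega)
    exact h1.trans (by simpa using (ih (a := a + 1) (i := i + 2) (by omega) L).right [cup a])

/-- When the maximum is lifted above the minimum, its legs end up between the strands that the
minimum joins. The two welded crossings exchange the left strands and the right strands, which
restores the nesting. -/
theorem cup_cap (a : ℕ) (L : List Dir) :
    Sim L [cup a, cap a .down] [cap (a + 1) .down, rho (a + 2), rho a, cup (a + 1)] := by
  induction a generalizing L with
  | zero =>
    match L with
    | [] => exact of_none rfl rfl
    | [_] => exact of_none rfl rfl
    | x :: y :: L =>
      calc Sim (x :: y :: L) [cup 0, cap 0 .down] [cap 2 .down, cup 0] :=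
            exch .cup (.cap .down) (i := 0) (j := 0) (j' := 2) 0 _
        Sim (x :: y :: L) _ [cap 2 .down, rho 1, rho 1, cup 0] :=
            ctx [cap 2 .down] [cup 0] (u := []) (v := [rho 1, rho 1]) (by
              rintro M ⟨⟩; exact ((rho_rho _ _ _).sh _).symm)
        Sim (x :: y :: L) _ [cap 1 .down, rho 2, rho 1, cup 0] :=
            right [rho 1, cup 0] (cap_cross 1 .down .welded _).symm
        Sim (x :: y :: L) _ [cap 1 .down, rho 2, rho 0, cup 1] :=
            left [cap 1 .down, rho 2] (u := [rho 1, cup 0]) (v := [rho 0, cup 1])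
              fun M _ => (cup_cross 0 .welded M).symm
  | succ a ih => exact sh_all ih (by simp) (by simp) L

theorem exists_cups_cap (a m : ℕ) : ∃ y, (∀ s ∈ y, Inner (a + m + 1) s) ∧ ∀ L,
    Sim L (cups a m ++ [cap a .down]) (cap (a + m) .down :: (y ++ cups (a + 1) m)) := by
  induction m generalizing a with
  | zero => exact ⟨[], by simp, fun L => refl _ _⟩
  | succ m ih =>
    obtain ⟨y, hy, hs⟩ := ih (a + 1)
    refine ⟨y ++ [rho (a + 2 + 2 * m), rho a], ?_, fun L => ?_⟩
    · intro s h
      simp only [List.mem_append, List.mem_cons, List.not_mem_nil, or_false] at h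
      rcases h with h | rfl | rfl
      · rw [show a + (m + 1) + 1 = a + 1 + m + 1 by omega]
        exact hy s h
      · exact .right (by omega) (by omega)
      · exact .left _ (by omega)
    · rw [cups_succ, show a + (m + 1) = a + 1 + m by omega]
      have h1 : Sim L (cups (a + 1) m ++ [cup a, cap a .down])
          (cups (a + 1) m ++ [cap (a + 1) .down, rho (a + 2), rho a, cup (a + 1)]) :=
        left _ fun M _ => cup_cap a M
      have h2 := (hs L).right [rho (a + 2), rho a, cup (a + 1)]
      have h3 : Sim L (cap (a + 1 + m) .down :: y ++ (cups (a + 1 + 1) m ++ [rho (a + 2)]) ++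
          [rho a, cup (a + 1)]) (cap (a + 1 + m) .down :: y ++ (rho (a + 2 + 2 * m) ::
            cups (a + 1 + 1) m) ++ [rho a, cup (a + 1)]) :=
        ctx _ _ fun M _ => cups_right (by omega) .welded m M
      have h4 : Sim L (cap (a + 1 + m) .down :: y ++ [rho (a + 2 + 2 * m)] ++
          (cups (a + 1 + 1) m ++ [rho a]) ++ [cup (a + 1)])
          (cap (a + 1 + m) .down :: y ++ [rho (a + 2 + 2 * m)] ++
          (rho a :: cups (a + 1 + 1) m) ++ [cup (a + 1)]) :=
        ctx _ _ fun M _ => cups_left (by omega) .welded m M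
      rw [cups_succ]
      simp only [List.append_assoc, List.cons_append, List.nil_append] at h1 h2 h3 h4 ⊢
      exact ((h1.trans h2).trans h3).trans h4

/-- Every inner crossing lies entirely to the left or to the right of the middle, so a maximum there
passes by height exchanges; only crossings on the right are renumbered. -/
theorem exists_inner_cap {n : ℕ} {x : Word} (hx : ∀ s ∈ x, Inner n s) :
    ∃ y, (∀ s ∈ y, Inner (n + 1) s) ∧ ∀ L, Sim L (x ++ [cap n .down]) (cap n .down :: y) := by
  induction x with
  | nil => exact ⟨[], by simp, fun L => refl _ _⟩
  | cons s x ih =>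
    obtain ⟨y, hy, hs⟩ := ih fun t ht => hx t (by simp [ht])
    obtain ⟨t, ht, hst⟩ : ∃ t, Inner (n + 1) t ∧ ∀ L, Sim L [s, cap n .down] [cap n .down, t] := by
      cases hx s (by simp) with
      | @left k i h =>
        exact ⟨cr k i, .left k (by omega), fun L => exch (.cross k) (.cap .down) (n - (i + 2)) L
          (by simp only [Elem.out]; omega) (by simp only [Elem.inp]; omega)⟩
      | @right i hi h =>
        exact ⟨rho (i + 2), .right (by omega) (by omega),
          fun L => (exch (.cap .down) (.cross .welded) (i - n) L
            (by simp only [Elem.out]; omega) (by simp only [Elem.inp]; omega)).symm⟩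
    refine ⟨t :: y, by simpa using ⟨ht, hy⟩, fun L => ?_⟩
    exact (cons s fun M _ => hs M).trans ((hst L).right y)

/-- The invariant of the induction is a block of nested maxima, then the inner crossings `x`
collected so far, then `m` postponed minima, then the rest `w`. Equality of the two strand counts is
what places the middle of the line at the innermost maximum. -/
theorem exists_closed {w : Word} {a b a' b' : ℕ} (hw : Std w a b a' b') (hab : b = a) :
    ∀ m x, (∀ s ∈ x, Inner (a + m) s) → ∃ m' x', (∀ s ∈ x', Inner (a' + m') s) ∧
      ∀ L, Sim L (closureTop (a + m) ++ (x ++ (cups a m ++ w)))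
        (closureTop (a' + m') ++ (x' ++ cups a' m')) := by
  induction hw with
  | nil => exact fun m x hx => ⟨m, x, hx, fun L => by simp [refl]⟩
  | @down k i a b a' b' w h _ ih =>
    intro m x hx
    obtain ⟨m', x', hx', hs⟩ := ih hab m (x ++ [cr k i]) (by
      intro s hs
      rcases List.mem_append.1 hs with hs | hs
      · exact hx s hs
      · rw [List.mem_singleton.1 hs]
        exact .left k (by omega))
    refine ⟨m', x', hx', fun L => Sim.trans ?_ (hs L)⟩
    have := ctx (L := L) (closureTop (a + m) ++ x) w fun M _ => cups_left h k m M
    simpa using this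
  | @up i a b a' b' w hi h _ ih =>
    intro m x hx
    obtain ⟨m', x', hx', hs⟩ := ih hab m (x ++ [rho (i + 2 * m)]) (by
      intro s hs
      rcases List.mem_append.1 hs with hs | hs
      · exact hx s hs
      · rw [List.mem_singleton.1 hs]
        exact .right (by omega) (by omega))
    refine ⟨m', x', hx', fun L => Sim.trans ?_ (hs L)⟩
    have := ctx (L := L) (closureTop (a + m) ++ x) w fun M _ => cups_right hi .welded m M
    simpa using this
  | @cap a b a' b' w _ ih =>
    intro m x hx
    -- The maximum is lifted first above the postponed minima, then above `x`, and becomes the new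
    -- innermost maximum.
    obtain ⟨y, hy, hys⟩ := exists_cups_cap a m
    obtain ⟨z, hz, hzs⟩ := exists_inner_cap hx
    obtain ⟨m', x', hx', hs⟩ := ih (by omega) m (z ++ y) (by
      intro s hs
      rw [show a + 1 + m = a + m + 1 by omega]
      rcases List.mem_append.1 hs with hs | hs
      · exact hz s hs
      · exact hy s hs)
    refine ⟨m', x', hx', fun L => Sim.trans ?_ (hs L)⟩
    have h1 := ctx (L := L) (closureTop (a + m) ++ x) w fun M _ => hys M
    have h2 := ctx (L := L) (closureTop (a + m)) (y ++ (cups (a + 1) m ++ w)) fun M _ => hzs M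
    rw [show a + 1 + m = a + m + 1 by omega, closureTop_succ]
    simp only [List.append_assoc, List.cons_append, List.nil_append] at h1 h2 ⊢
    exact h1.trans h2
  | @cup a b a' b' w _ ih =>
    intro m x hx
    -- A minimum is simply postponed: it is the outermost of the `m + 1` minima now waiting.
    obtain ⟨m', x', hx', hs⟩ := ih (by omega) (m + 1) x (by
      rwa [show a + (m + 1) = a + 1 + m by omega])
    refine ⟨m', x', hx', fun L => Sim.trans ?_ (hs L)⟩
    rw [cups_succ, show a + (m + 1) = a + 1 + m by omega]
    simp [refl]

/-- A welded crossing on the right of nested maxima slides to the left. -/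
theorem exists_closureTop_rho {n i : ℕ} (h : i + 2 ≤ n) : ∃ j, j + 2 ≤ n ∧ ∀ L,
    Sim L (closureTop n ++ [rho (n + i)]) (closureTop n ++ [rho j]) := by
  induction n generalizing i with
  | zero => omega
  | succ n ih =>
    cases i with
    | zero =>
      obtain ⟨p, rfl⟩ := Nat.exists_eq_add_of_le' (show 1 ≤ n by omega)
      refine ⟨p, by omega, fun L => ?_⟩
      simp only [closureTop_succ, List.append_assoc]
      refine left _ fun M _ => ?_
      -- The crossing slides over the inner maximum, the two maxima, now side by side, exchange
      -- heights, and the crossing slides over the other one.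
      calc Sim M [cap p .down, cap (p + 1) .down, rho (p + 2)]
              [cap p .down, cap (p + 2) .down, rho (p + 1)] :=
            left [cap p .down] fun K _ => cap_cross (p + 1) .down .welded K
        Sim M _ [cap p .down, cap p .down, rho (p + 1)] :=
            right [rho (p + 1)] (exch (.cap .down) (.cap .down) 0 M)
        Sim M _ [cap p .down, cap (p + 1) .down, rho p] :=
            left [cap p .down] fun K _ => cap_cross p .down .welded K
    | succ i =>
      obtain ⟨j, hj, hs⟩ := ih (i := i) (by omega)
      refine ⟨j, by omega, fun L => ?_⟩
      rw [closureTop_succ, List.append_assoc, List.append_assoc]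
      have h1 : Sim L (closureTop n ++ [cap n .down, rho (n + 1 + (i + 1))])
          (closureTop n ++ [rho (n + i), cap n .down]) :=
        left _ fun M _ => exch (.cap .down) (.cross .welded) i M
          (by simp only [Elem.out]; omega) (by simp only [Elem.inp]; omega)
      have h2 := (hs L).right [cap n .down]
      have h3 : Sim L (closureTop n ++ [rho j, cap n .down])
          (closureTop n ++ [cap n .down, rho j]) :=
        left _ fun M _ => exch (.cross .welded) (.cap .down) (n - (j + 2)) M
          (by simp only [Elem.out]; omega) (by simp only [Elem.inp]; omega)
      exact (h1.trans (by simpa using h2)).trans h3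

theorem comm_left_rho {n i : ℕ} (hi : n ≤ i) {x : Word} (hx : ∀ s ∈ x, ∃ k j, j + 2 ≤ n ∧ s = cr k j)
    (L : List Dir) : Sim L (x ++ [rho i]) (rho i :: x) := by
  induction x generalizing L with
  | nil => rfl
  | cons s x ih =>
    obtain ⟨k, j, hj, rfl⟩ := hx s (by simp)
    refine (cons (cr k j) fun M _ => ih (fun t ht => hx t (by simp [ht])) M).trans
      (right x (exch (.cross k) (.cross .welded) (i - (j + 2)) L ?_ ?_)) <;>
    simp only [Elem.inp, Elem.out] <;> omega

/-- Working from the top down, the crossings above the current one are already on the left. A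
crossing on the right therefore rises freely to the maxima and slides around them. -/
theorem exists_left {n : ℕ} {x : Word} (hx : ∀ s ∈ x, Inner n s) :
    ∃ y : Word, (∀ s ∈ y, ∃ k j, j + 2 ≤ n ∧ s = cr k j) ∧
      ∀ L, Sim L (closureTop n ++ x) (closureTop n ++ y) := by
  induction x using List.reverseRecOn with
  | nil => exact ⟨[], by simp, fun L => refl _ _⟩
  | append_singleton x s ih =>
    obtain ⟨y, hy, hs⟩ := ih fun t ht => hx t (by simp [ht])
    have h1 : ∀ L, Sim L (closureTop n ++ (x ++ [s])) (closureTop n ++ (y ++ [s])) := fun L => by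
      simpa using (hs L).right [s]
    cases hx s (by simp) with
    | @left k i h =>
      refine ⟨y ++ [cr k i], ?_, h1⟩
      intro t ht
      rcases List.mem_append.1 ht with ht | ht
      · exact hy t ht
      · exact ⟨k, i, h, List.mem_singleton.1 ht⟩
    | @right i hi h =>
      obtain ⟨p, rfl⟩ := Nat.exists_eq_add_of_le hi
      obtain ⟨j, hj, hjs⟩ := exists_closureTop_rho (n := n) (i := p) (by omega)
      refine ⟨rho j :: y, ?_, fun L => ?_⟩
      · intro t ht
        rcases List.mem_cons.1 ht with rfl | ht
        · exact ⟨_, j, hj, rfl⟩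
        · exact hy t ht
      · refine (h1 L).trans ((left _ fun M _ => comm_left_rho hi hy M).trans ?_)
        simpa using (hjs L).right y

end Sim

/-- Alexander's theorem for diagrams without wen marks. -/
theorem exists_braid {w : Word} (hw : WenFree w) (h : runF w [] = some []) :
    ∃ (n : ℕ) (b : BraidDiagram n), b.IsWelded ∧ Sim [] w b.closed.word := by
  obtain ⟨v, hv, hs⟩ := exists_std hw h
  obtain ⟨n, x, hx, hxs⟩ := Sim.exists_closed hv rfl 0 [] (by simp)
  obtain ⟨y, hy, hys⟩ := Sim.exists_left hx
  rw [zero_add] at hy hys hxs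
  refine ⟨n, ⟨y, fun s hs => ?_⟩, fun s hs => ?_, ?_⟩
  · obtain ⟨k, j, hj, rfl⟩ := hy s hs
    exact .cross k j hj
  · obtain ⟨k, j, hj, rfl⟩ := hy s hs
    simp
  · refine hs.trans ((hxs []).trans ?_)
    rw [cups_zero, ← List.append_assoc, zero_add]
    exact (hys []).right _

/-! ### Cancelling wen marks along a labelling -/

/-- The slice `s` joins the strands of a line with labels `l` to those of the next line with labels
`m`, where exactly the wen marks change the labels. -/
inductive LabelStep : Slice → List Bool → List Bool → Prop
  | cross (k : Crossing) (a b : Bool) (l : List Bool) : LabelStep (cr k 0) (a :: b :: l) (b :: a :: l)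
  | wen (a : Bool) (l : List Bool) : LabelStep (tau 0) (a :: l) ((!a) :: l)
  | cap (d : Dir) (a : Bool) (l : List Bool) : LabelStep (cap 0 d) l (a :: a :: l)
  | cup (a : Bool) (l : List Bool) : LabelStep (cup 0) (a :: a :: l) l
  | succ {i : ℕ} {e : Elem} (a : Bool) {l m : List Bool} :
      LabelStep ⟨i, e⟩ l m → LabelStep ⟨i + 1, e⟩ (a :: l) (a :: m)

/-- A labelling of the strands of a word that changes exactly at the wen marks. -/
inductive Labelled : Word → List Bool → List Bool → Prop
  | nil (l : List Bool) : Labelled [] l l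
  | cons {s : Slice} {w : Word} {l m n : List Bool} :
      LabelStep s l m → Labelled w m n → Labelled (s :: w) l n

/-- A wen mark on the leftmost strand if its label is `true`. -/
def wenBit : Bool → Word
  | true => [tau 0]
  | false => []

/-- Wen marks on the strands with label `true`. -/
def wens : List Bool → Word
  | [] => []
  | a :: l => wenBit a ++ sh (wens l)

theorem runF_wenBit {a : Bool} {x : Dir} {L : List Dir} : runF (wenBit a) (x :: L) = some (x :: L) := by
  cases a <;> rfl

theorem runF_wens {l : List Bool} {L M : List Dir} (h : runF (wens l) L = some M) : L = M := by
  induction l generalizing L M with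
  | nil =>
    cases h
    rfl
  | cons a l ih =>
    cases L with
    | nil =>
      cases a with
      | true => cases h
      | false =>
        rw [wens, wenBit, List.nil_append] at h
        by_cases hl : wens l = []
        · rw [hl] at h
          cases h
          rfl
        · rw [runF_sh_nil hl] at h
          cases h
    | cons x L =>
      rw [wens, runF_append, runF_wenBit, Option.bind_some, runF_sh_cons,
        Option.map_eq_some_iff] at h
      obtain ⟨N, hN, rfl⟩ := h
      rw [ih hN]

/-- Consecutive crossings of the two leftmost strands. -/
def twist (c : List Crossing) : Word := c.map fun k => cr k 0

theorem twist_wenFree (c : List Crossing) : WenFree (twist c) := by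
  intro s hs
  obtain ⟨k, _, rfl⟩ := List.mem_map.1 hs
  simp

theorem runF_twist (c : List Crossing) (x y : Dir) (L : List Dir) :
    ∃ x' y', runF (twist c) (x :: y :: L) = some (x' :: y' :: L) := by
  induction c generalizing x y with
  | nil => exact ⟨x, y, rfl⟩
  | cons k c ih => exact ih y x

namespace Sim

/-- A mark may turn a classical crossing into three crossings. Only the parity of their number is
recorded, as it decides on which of the two strand positions the mark comes out. -/
theorem tau_zero_cross (k : Crossing) : ∃ c : List Crossing, c.length % 2 = 1 ∧
    ∀ x y L, Sim (x :: y :: L) [tau 0, cr k 0] (twist c ++ [tau 1]) := by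
  cases k with
  | welded => exact ⟨[.welded], rfl, fun x y L => braid (.T2 0) rfl⟩
  | overRight => exact ⟨[.overRight], rfl, fun x y L => braid (.T3 0) rfl⟩
  | overLeft =>
    refine ⟨[.welded, .overRight, .welded], rfl, fun x y L => ?_⟩
    calc Sim (x :: y :: L) [tau 0, sigInv 0] [tau 0, rho 0, rho 0, sigInv 0] :=
          (braid_mid [tau 0] [sigInv 0] (.V2 0) rfl).symm
      Sim (x :: y :: L) _ [rho 0, tau 1, rho 0, sigInv 0] := braid_mid [] [rho 0, sigInv 0] (.T2 0) rfl
      Sim (x :: y :: L) _ [rho 0, tau 1, rho 0, sigInv 0, rho 0, rho 0] :=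
          (braid_mid [rho 0, tau 1, rho 0, sigInv 0] [] (.V2 0) rfl).symm
      Sim (x :: y :: L) _ [rho 0, tau 1, rho 0, sigInv 0, rho 0, tau 0, tau 0, rho 0] :=
          (braid_mid [rho 0, tau 1, rho 0, sigInv 0, rho 0] [rho 0] (.T1 0) rfl).symm
      Sim (x :: y :: L) _ [rho 0, tau 1, tau 1, sig 0, tau 0, rho 0] :=
          (braid_mid [rho 0, tau 1] [tau 0, rho 0] (.T4 0) rfl).symm
      Sim (x :: y :: L) _ [rho 0, sig 0, tau 0, rho 0] :=
          braid_mid [rho 0] [sig 0, tau 0, rho 0] (.T1 1) rfl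
      Sim (x :: y :: L) _ [rho 0, sig 0, rho 0, tau 1] := braid_mid [rho 0, sig 0] [] (.T2 0) rfl

theorem tau_one_cross (k : Crossing) : ∃ c : List Crossing, c.length % 2 = 1 ∧
    ∀ x y L, Sim (x :: y :: L) [tau 1, cr k 0] (twist c ++ [tau 0]) := by
  cases k with
  | welded =>
    refine ⟨[.welded], rfl, fun x y L => ?_⟩
    calc Sim (x :: y :: L) [tau 1, rho 0] [rho 0, rho 0, tau 1, rho 0] :=
          (braid_mid [] [tau 1, rho 0] (.V2 0) rfl).symm
      Sim (x :: y :: L) _ [rho 0, tau 0, rho 0, rho 0] := (braid_mid [rho 0] [rho 0] (.T2 0) rfl).symm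
      Sim (x :: y :: L) _ [rho 0, tau 0] := braid_mid [rho 0, tau 0] [] (.V2 0) rfl
  | overRight =>
    exact ⟨[.welded, .overLeft, .welded], rfl, fun x y L => braid (.T4 0) rfl⟩
  | overLeft =>
    refine ⟨[.overLeft], rfl, fun x y L => ?_⟩
    calc Sim (x :: y :: L) [tau 1, sigInv 0] [sigInv 0, sig 0, tau 1, sigInv 0] :=
          (braid_mid [] [tau 1, sigInv 0] (.R2' 0) rfl).symm
      Sim (x :: y :: L) _ [sigInv 0, tau 0, sig 0, sigInv 0] :=
          (braid_mid [sigInv 0] [sigInv 0] (.T3 0) rfl).symm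
      Sim (x :: y :: L) _ [sigInv 0, tau 0] := braid_mid [sigInv 0, tau 0] [] (.R2 0) rfl

theorem tau_cross {p : ℕ} (hp : p < 2) (k : Crossing) : ∃ c : List Crossing, c.length % 2 = 1 ∧
    ∀ x y L, Sim (x :: y :: L) [tau p, cr k 0] (twist c ++ [tau ((p + 1) % 2)]) := by
  interval_cases p
  exacts [tau_zero_cross k, tau_one_cross k]

theorem tau_twist {p : ℕ} (hp : p < 2) (c : List Crossing) :
    ∃ c' : List Crossing, c'.length % 2 = c.length % 2 ∧ ∀ x y L,
      Sim (x :: y :: L) (tau p :: twist c) (twist c' ++ [tau ((p + c.length) % 2)]) := by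
  induction c generalizing p with
  | nil => exact ⟨[], rfl, fun x y L => by simp [twist, Nat.mod_eq_of_lt hp, refl]⟩
  | cons k c ih =>
    obtain ⟨c₁, h₁, hs₁⟩ := tau_cross hp k
    obtain ⟨c₂, h₂, hs₂⟩ := ih (p := (p + 1) % 2) (Nat.mod_lt _ (by omega))
    refine ⟨c₁ ++ c₂, by simp only [List.length_append, List.length_cons]; omega, fun x y L => ?_⟩
    have h3 : Sim (x :: y :: L) (twist c₁ ++ tau ((p + 1) % 2) :: twist c)
        (twist c₁ ++ (twist c₂ ++ [tau (((p + 1) % 2 + c.length) % 2)])) :=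
      left _ fun M hM => by
        obtain ⟨x', y', h⟩ := runF_twist c₁ x y L
        rw [h] at hM
        cases hM
        exact hs₂ _ _ _
    have h4 := (hs₁ x y L).right (twist c)
    rw [show (p + (k :: c).length) % 2 = ((p + 1) % 2 + c.length) % 2 by
      simp only [List.length_cons]; omega]
    have h5 : twist (k :: c) = cr k 0 :: twist c := rfl
    have h6 : twist (c₁ ++ c₂) = twist c₁ ++ twist c₂ := List.map_append
    rw [h5, h6, List.append_assoc]
    exact trans (by simpa using h4) h3

theorem exists_bits_cross (k : Crossing) (a b : Bool) : ∃ u, WenFree u ∧ ∀ x y L,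
    Sim (x :: y :: L) (wenBit a ++ ExtWelded.sh (wenBit b) ++ [cr k 0])
      (u ++ wenBit b ++ ExtWelded.sh (wenBit a)) := by
  cases a <;> cases b
  · exact ⟨[cr k 0], twist_wenFree [k], fun x y L => refl _ _⟩
  · obtain ⟨c, _, hs⟩ := tau_one_cross k
    exact ⟨twist c, twist_wenFree c, fun x y L => by simpa [wenBit] using hs x y L⟩
  · obtain ⟨c, _, hs⟩ := tau_zero_cross k
    exact ⟨twist c, twist_wenFree c, fun x y L => by simpa [wenBit] using hs x y L⟩
  · obtain ⟨c, h, hs⟩ := tau_one_cross k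
    obtain ⟨c', _, hs'⟩ := tau_twist (p := 0) (by omega) c
    refine ⟨twist c', twist_wenFree c', fun x y L => ?_⟩
    -- The mark nearer to the crossing goes first; the other then meets the whole twist `c`, and the
    -- odd length of `c` brings it out on strand one.
    have h1 : Sim (x :: y :: L) [tau 0, tau 1, cr k 0] (tau 0 :: (twist c ++ [tau 0])) :=
      cons _ (by rintro M ⟨⟩; exact hs x y L)
    have h2 := (hs' x y L).right [tau 0]
    rw [zero_add, h] at h2
    have h3 : Sim (x :: y :: L) (twist c' ++ [tau 1, tau 0]) (twist c' ++ [tau 0, tau 1]) :=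
      left _ fun M _ => (exch .wen .wen 0 M).symm
    simpa [wenBit] using (h1.trans h2).trans (by simpa using h3)

/-- One step of the sweep. A mark of the diagram cancels against a carried mark if there is one, and
otherwise becomes a carried mark; this is why the label flips there. -/
theorem exists_wens_slice {s : Slice} {l m : List Bool} (h : LabelStep s l m) {L M : List Dir}
    (hM : runF [s] L = some M) :
    ∃ u, WenFree u ∧ Sim L (wens l ++ [s]) (u ++ wens m) := by
  induction h generalizing L M with
  | cross k a b l =>
    match L, hM with
    | x :: y :: L, _ =>
      obtain ⟨u, hu, hs⟩ := exists_bits_cross k a b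
      refine ⟨u, hu, ?_⟩
      have h1 : Sim (x :: y :: L) (wenBit a ++ ExtWelded.sh (wenBit b) ++
          (ExtWelded.sh (ExtWelded.sh (wens l)) ++ [cr k 0])) (wenBit a ++ ExtWelded.sh (wenBit b) ++
          (cr k 0 :: ExtWelded.sh (ExtWelded.sh (wens l)))) :=
        left _ fun M _ => (comm_cross k (wens l) M).symm
      have h2 := (hs x y L).right (ExtWelded.sh (ExtWelded.sh (wens l)))
      simp only [wens, sh_append, List.append_assoc, List.cons_append, List.nil_append] at h1 h2 ⊢
      exact h1.trans h2
  | wen a l =>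
    match L, hM with
    | x :: L, _ =>
      refine ⟨[], by simp [WenFree], ?_⟩
      have h1 : Sim (x :: L) (wenBit a ++ (ExtWelded.sh (wens l) ++ [tau 0]))
          (wenBit a ++ (tau 0 :: ExtWelded.sh (wens l))) :=
        left _ fun M _ => (comm_wen (wens l) M).symm
      rw [wens, List.append_assoc]
      refine h1.trans ?_
      cases a with
      | false => exact refl _ _
      | true => exact right (L := x :: L) (u := [tau 0, tau 0]) (v := []) _ (braid (.T1 0) rfl)
  | cap d a l =>
    refine ⟨[cap 0 d], by simp [WenFree], (comm_cap d (wens l) L).symm.trans ?_⟩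
    cases a with
    | false => exact refl _ _
    | true =>
      refine right (u := [cap 0 d]) (v := [cap 0 d, tau 0, tau 1])
        (ExtWelded.sh (ExtWelded.sh (wens l))) ?_
      -- A cancelling pair is born on the right leg and one of its marks moves over the maximum.
      calc Sim L [cap 0 d] [cap 0 d, tau 1, tau 1] := (braid_mid [cap 0 d] [] (.T1 1) rfl).symm
        Sim L _ [cap 0 d, tau 0, tau 1] :=
            (mid [] [tau 1] (.inr (.inl (.cap_wen 0 d))) rfl).symm
  | cup a l =>
    match L, hM with
    | x :: y :: L, _ =>
      refine ⟨[cup 0], by simp [WenFree], ?_⟩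
      cases a with
      | false => exact (comm_cup (wens l) _).symm
      | true =>
        have h1 : Sim (x :: y :: L)
            ([tau 0, tau 1] ++ (ExtWelded.sh (ExtWelded.sh (wens l)) ++ [cup 0]))
            ([tau 0, tau 1] ++ (cup 0 :: wens l)) :=
          left _ fun M _ => (comm_cup (wens l) M).symm
        refine trans h1 (right (u := [tau 0, tau 1, cup 0]) (v := [cup 0]) (wens l) ?_)
        calc Sim (x :: y :: L) [tau 0, tau 1, cup 0] [tau 0, tau 0, cup 0] :=
              (mid [tau 0] [] (.inr (.inl (.cup_wen 0))) rfl).symm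
          Sim (x :: y :: L) _ [cup 0] := braid_mid [] [cup 0] (.T1 0) rfl
  | @succ i e a l m h ih =>
    cases L with
    | nil => cases hM
    | cons x L =>
      change runF (ExtWelded.sh [⟨i, e⟩]) (x :: L) = some M at hM
      rw [runF_sh_cons, Option.map_eq_some_iff] at hM
      obtain ⟨N, hN, rfl⟩ := hM
      obtain ⟨u, hu, hs⟩ := ih hN
      refine ⟨ExtWelded.sh u, hu.sh, ?_⟩
      have h1 : Sim (x :: L) (wenBit a ++ ExtWelded.sh (wens l ++ [⟨i, e⟩]))
          (wenBit a ++ ExtWelded.sh (u ++ wens m)) :=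
        left _ fun K hK => by
          rw [runF_wenBit] at hK
          cases hK
          exact hs.sh x
      have h2 : Sim (x :: L) (wenBit a ++ ExtWelded.sh u) (ExtWelded.sh u ++ wenBit a) := by
        cases a with
        | false => simp [wenBit, refl]
        | true => exact comm_wen u _
      have h3 := h2.right (ExtWelded.sh (wens m))
      simp only [wens, sh_append, List.append_assoc] at h1 h3 ⊢
      exact h1.trans h3

theorem exists_wens {w : Word} {l m : List Bool} (h : Labelled w l m) {L M : List Dir}
    (hL : runF (wens l) L = some L) (hM : runF w L = some M) :
    ∃ u, WenFree u ∧ Sim L (wens l ++ w) (u ++ wens m) := by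
  induction h generalizing L M with
  | nil l => exact ⟨[], by simp [WenFree], by simp [refl]⟩
  | @cons s w l m n hs _ ih =>
    simp only [runF, Option.bind_eq_some_iff] at hM
    obtain ⟨N, hN, hM⟩ := hM
    have hsN : runF [s] L = some N := by simp [runF, hN]
    obtain ⟨u, hu, hsim⟩ := exists_wens_slice hs hsN
    have hrun := hsim.runF_eq
    rw [runF_append, hL, Option.bind_some, hsN, runF_append, eq_comm,
      Option.bind_eq_some_iff] at hrun
    obtain ⟨K, hK, hKN⟩ := hrun
    obtain rfl := runF_wens hKN
    obtain ⟨v, hv, hvs⟩ := ih hKN hM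
    refine ⟨u ++ v, hu.append hv, ?_⟩
    have h1 := hsim.right w
    have h2 : Sim L (u ++ (wens m ++ w)) (u ++ (v ++ wens n)) :=
      left _ fun J hJ => by
        rw [hK] at hJ
        cases hJ
        exact hvs
    simp only [List.append_assoc, List.cons_append, List.nil_append] at h1 h2 ⊢
    exact h1.trans h2

end Sim

theorem exists_wenFree {w : Word} (h : Labelled w [] []) (hw : runF w [] = some []) :
    ∃ u, WenFree u ∧ Sim [] w u := by
  obtain ⟨u, hu, hs⟩ := Sim.exists_wens h rfl hw
  exact ⟨u, hu, by simpa [wens] using hs⟩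

/-! ### Existence of labellings

The pieces of the strands inside a slice `s` are numbered. A labelling is a function on the points of
the diagram whose coboundary is the indicator function of the wen marks; by linear duality over the
field with two elements it suffices that this indicator function vanishes on all cycles. -/

/-- The number of the piece of a strand of `s` that starts at the top point `p`. -/
def topEdge : Slice → ℕ → ℕ
  | ⟨_, .cross _⟩, p => p
  | ⟨_, .wen⟩, p => p
  | ⟨i, .cap _⟩, p => if p < i then p else p + 1
  | ⟨i, .cup⟩, p => if p ≤ i then p else p - 1

/-- The number of the piece of a strand of `s` that ends at the bottom point `p`. -/
def botEdge : Slice → ℕ → ℕ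
  | ⟨i, .cross _⟩, p => if p = i then i + 1 else if p = i + 1 then i else p
  | ⟨_, .wen⟩, p => p
  | ⟨i, .cap _⟩, p => if p ≤ i then p else p - 1
  | ⟨i, .cup⟩, p => if p < i then p else p + 1

/-- The endpoints of the piece with number `j` of a strand of the slice `s` below the line `k`. -/
def edgeEnds : Slice → ℕ → ℕ → (ℕ × ℕ) × (ℕ × ℕ)
  | ⟨i, .cross _⟩, k, j => ((k, j), (k + 1, if j = i then i + 1 else if j = i + 1 then i else j))
  | ⟨_, .wen⟩, k, j => ((k, j), (k + 1, j))
  | ⟨i, .cap _⟩, k, j =>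
    if j < i then ((k, j), (k + 1, j))
    else if j = i then ((k + 1, i), (k + 1, i + 1)) else ((k, j - 1), (k + 1, j + 1))
  | ⟨i, .cup⟩, k, j =>
    if j < i then ((k, j), (k + 1, j))
    else if j = i then ((k, i), (k, i + 1)) else ((k, j + 1), (k + 1, j - 1))

/-- The indicator function of a point, as a `0`-chain. -/
noncomputable abbrev pt (P : ℕ × ℕ) : ℕ × ℕ →₀ ZMod 2 := Finsupp.single P 1

/-- The boundary of a piece of a strand. -/
noncomputable def edgeBoundary (w : Word) (e : ℕ × ℕ) : ℕ × ℕ →₀ ZMod 2 :=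
  match w[e.1]? with
  | some s => pt (edgeEnds s e.1 e.2).1 + pt (edgeEnds s e.1 e.2).2
  | none => 0

/-- The boundary map from `1`-chains to `0`-chains of a diagram. -/
noncomputable def boundary (w : Word) : (ℕ × ℕ →₀ ZMod 2) →ₗ[ZMod 2] (ℕ × ℕ →₀ ZMod 2) :=
  Finsupp.linearCombination (ZMod 2) (edgeBoundary w)

/-- The coefficient of a `1`-chain at the piece below a point. -/
def coeffBelow (w : Word) (P : ℕ × ℕ) (z : ℕ × ℕ →₀ ZMod 2) : ZMod 2 :=
  match w[P.1]? with
  | some s => z (P.1, topEdge s P.2)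
  | none => 0

/-- The coefficient of a `1`-chain at the piece above a point. -/
def coeffAbove (w : Word) : ℕ × ℕ → (ℕ × ℕ →₀ ZMod 2) → ZMod 2
  | (0, _), _ => 0
  | (k + 1, p), z =>
    match w[k]? with
    | some s => z (k, botEdge s p)
    | none => 0

/-- Inside one slice every point of the two bounding lines is an end of exactly one piece, the one
named by `topEdge` or `botEdge`. Numbering also the positions beyond the last strand keeps this free
of bounds. -/
theorem edgeEnds_apply (s : Slice) (k j l p : ℕ) :
    (pt (edgeEnds s k j).1 + pt (edgeEnds s k j).2) (l, p) =
      (if l = k ∧ topEdge s p = j then 1 else 0) + (if l = k + 1 ∧ botEdge s p = j then 1 else 0) := by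
  obtain ⟨i, e⟩ := s
  have hs : ∀ a b : ℕ, (pt (a, b)) (l, p) = if l = a ∧ p = b then 1 else 0 := by
    intro a b
    rw [pt, Finsupp.single_apply]
    simp only [Prod.mk.injEq, eq_comm]
  rcases eq_or_ne l k with rfl | h1
  · cases e <;> simp only [edgeEnds, topEdge, botEdge] <;> split_ifs <;>
      simp only [Finsupp.add_apply, hs] <;> split_ifs <;> first | rfl | omega | grind
  · rcases eq_or_ne l (k + 1) with rfl | h2
    · cases e <;> simp only [edgeEnds, topEdge, botEdge] <;> split_ifs <;>
        simp only [Finsupp.add_apply, hs] <;> split_ifs <;> first | rfl | omega | grind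
    · rw [if_neg (fun h => h1 h.1), if_neg (fun h => h2 h.1)]
      cases e <;> simp only [edgeEnds] <;> (try split_ifs) <;>
        simp [Finsupp.add_apply, hs, h1, h2]

theorem boundary_apply (w : Word) (z : ℕ × ℕ →₀ ZMod 2) (P : ℕ × ℕ) :
    boundary w z P = coeffBelow w P z + coeffAbove w P z := by
  obtain ⟨l, p⟩ := P
  induction z using Finsupp.induction_linear with
  | zero =>
    have h1 : coeffBelow w (l, p) 0 = 0 := by
      simp only [coeffBelow]
      split <;> rfl
    have h2 : coeffAbove w (l, p) 0 = 0 := by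
      cases l <;> simp only [coeffAbove]
      split <;> rfl
    simp [h1, h2]
  | add z z' h h' =>
    have h1 : coeffBelow w (l, p) (z + z') = coeffBelow w (l, p) z + coeffBelow w (l, p) z' := by
      simp only [coeffBelow]
      split <;> simp
    have h2 : coeffAbove w (l, p) (z + z') = coeffAbove w (l, p) z + coeffAbove w (l, p) z' := by
      cases l <;> simp only [coeffAbove]
      · simp
      · split <;> simp
    rw [map_add, Finsupp.add_apply, h, h', h1, h2]
    ring
  | single e c =>
    obtain ⟨k, j⟩ := e
    rw [boundary, Finsupp.linearCombination_single, Finsupp.smul_apply, edgeBoundary]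
    have hB : coeffBelow w (l, p) (Finsupp.single (k, j) c) =
        match w[k]? with
        | some s => if l = k ∧ topEdge s p = j then c else 0
        | none => 0 := by
      simp only [coeffBelow]
      rcases eq_or_ne l k with rfl | h
      · cases w[l]? with
        | none => rfl
        | some s => simp [Finsupp.single_apply, eq_comm]
      · cases w[l]? <;> cases w[k]? <;> simp [h]
    have hA : coeffAbove w (l, p) (Finsupp.single (k, j) c) =
        match w[k]? with
        | some s => if l = k + 1 ∧ botEdge s p = j then c else 0
        | none => 0 := by
      cases l with
      | zero => cases w[k]? <;> simp [coeffAbove]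
      | succ l =>
        simp only [coeffAbove]
        rcases eq_or_ne l k with rfl | h
        · cases w[l]? with
          | none => rfl
          | some s => simp [Finsupp.single_apply, eq_comm]
        · cases w[l]? <;> cases w[k]? <;> simp [h]
    rw [hB, hA]
    cases w[k]? with
    | none => simp
    | some s =>
      simp only
      rw [edgeEnds_apply]
      split_ifs <;> simp [mul_add]

/-- For a cycle the pieces above and below a point have the same coefficient modulo two. The
coefficient at each point may thus be read on whichever side the joining piece lies. -/
theorem coeff_eq_of_joined {w : Word} {z : ℕ × ℕ →₀ ZMod 2} (hz : boundary w z = 0) {P Q : ℕ × ℕ}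
    (h : Joined w P Q) : coeffBelow w P z = coeffBelow w Q z := by
  have hc : ∀ P, coeffBelow w P z = coeffAbove w P z := by
    intro P
    have := boundary_apply w z P
    rw [hz, Finsupp.zero_apply] at this
    generalize coeffBelow w P z = a at *
    generalize coeffAbove w P z = b at *
    revert a b
    decide
  cases h with
  | @beside_left k s h p hp =>
    rw [hc (k + 1, p)]
    simp only [coeffBelow, coeffAbove, h]
    congr 2
    obtain ⟨i, e⟩ := s
    cases e <;> simp only [topEdge, botEdge] at hp ⊢ <;> grind
  | @beside_right k s h p =>
    rw [hc (k + 1, _)]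
    simp only [coeffBelow, coeffAbove, h]
    congr 2
    obtain ⟨i, e⟩ := s
    cases e <;> simp only [topEdge, botEdge, Elem.inp, Elem.out] <;> grind
  | @cross_left k i c h => rw [hc (k + 1, _)]; simp [coeffBelow, coeffAbove, h, topEdge, botEdge]
  | @cross_right k i c h => rw [hc (k + 1, _)]; simp [coeffBelow, coeffAbove, h, topEdge, botEdge]
  | @wen k i h => rw [hc (k + 1, _)]; simp [coeffBelow, coeffAbove, h, topEdge, botEdge]
  | @cap k i d h => rw [hc, hc]; simp [coeffAbove, h, botEdge]
  | @cup k i h => simp [coeffBelow, h, topEdge]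

theorem coeff_eq_of_sameComponent {w : Word} {z : ℕ × ℕ →₀ ZMod 2} (hz : boundary w z = 0)
    {P Q : ℕ × ℕ} (h : SameComponent w P Q) : coeffBelow w P z = coeffBelow w Q z := by
  induction h with
  | rel _ _ h => exact coeff_eq_of_joined hz h
  | refl => rfl
  | symm _ _ _ ih => exact ih.symm
  | trans _ _ _ _ _ ih ih' => exact ih.trans ih'

/-- The lines above the wen marks. -/
def wenLines (w : Word) : Finset ℕ :=
  (Finset.range w.length).filter fun k => w[k]?.map Slice.elem = some .wen

/-- The point above a wen mark. -/
def wenPoint (w : Word) (k : ℕ) : ℕ × ℕ := (k, (w[k]?.map Slice.pos).getD 0)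

theorem mem_wenLines {w : Word} {k : ℕ} : k ∈ wenLines w ↔ ∃ i, w[k]? = some (tau i) := by
  simp only [wenLines, Finset.mem_filter, Finset.mem_range]
  constructor
  · rintro ⟨_, h⟩
    obtain ⟨⟨i, e⟩, h, rfl⟩ := Option.map_eq_some_iff.1 h
    exact ⟨i, h⟩
  · rintro ⟨i, h⟩
    exact ⟨(List.getElem?_eq_some_iff.1 h).1, by simp [h]⟩

/-- The number of wen marks in a `1`-chain, modulo `2`. -/
noncomputable def wenCochain (w : Word) : Module.Dual (ZMod 2) (ℕ × ℕ →₀ ZMod 2) :=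
  ∑ k ∈ wenLines w, Finsupp.lapply (wenPoint w k)

theorem wenCochain_apply (w : Word) (z : ℕ × ℕ →₀ ZMod 2) :
    wenCochain w z = ∑ k ∈ wenLines w, z (wenPoint w k) := by
  simp [wenCochain]

/-- Grouped by component, the sum is a constant coefficient times the number of marks on that
component, which is even. -/
theorem wenCochain_eq_zero {w : Word} (hw : EvenWens w) {z : ℕ × ℕ →₀ ZMod 2}
    (hz : boundary w z = 0) : wenCochain w z = 0 := by
  classical
  rw [wenCochain_apply]
  have hpt : ∀ k ∈ wenLines w, z (wenPoint w k) = coeffBelow w (wenPoint w k) z := by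
    intro k hk
    obtain ⟨i, hi⟩ := mem_wenLines.1 hk
    simp [coeffBelow, wenPoint, hi, topEdge]
  rw [Finset.sum_congr rfl hpt]
  let S : Setoid (ℕ × ℕ) := Relation.EqvGen.setoid (Joined w)
  let q : ℕ → Quotient S := fun k => Quotient.mk S (wenPoint w k)
  rw [← Finset.sum_fiberwise_of_maps_to (t := (wenLines w).image q) (g := q)
    fun k hk => Finset.mem_image_of_mem q hk]
  refine Finset.sum_eq_zero fun c hc => ?_
  obtain ⟨k₀, hk₀, rfl⟩ := Finset.mem_image.1 hc
  rw [Finset.sum_congr rfl (g := fun _ => coeffBelow w (wenPoint w k₀) z) fun k hk =>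
    coeff_eq_of_sameComponent hz (Quotient.exact (Finset.mem_filter.1 hk).2), Finset.sum_const]
  have hset : {k : ℕ | ∃ i, w[k]? = some (tau i) ∧ SameComponent w (wenPoint w k₀) (k, i)} =
      ((wenLines w).filter fun k => q k = q k₀ : Finset ℕ) := by
    ext k
    simp only [Set.mem_ofPred_eq, Finset.coe_filter, mem_wenLines]
    constructor
    · rintro ⟨i, hi, h⟩
      refine ⟨⟨i, hi⟩, Quotient.sound (s := S) ?_⟩
      have : wenPoint w k = (k, i) := by simp [wenPoint, hi]
      rw [this]
      exact Relation.EqvGen.symm _ _ h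
    · rintro ⟨⟨i, hi⟩, h⟩
      have : wenPoint w k = (k, i) := by simp [wenPoint, hi]
      exact ⟨i, hi, this ▸ Relation.EqvGen.symm _ _ (Quotient.exact h)⟩
  have := hw (wenPoint w k₀)
  rw [hset, Set.ncard_coe_finset] at this
  obtain ⟨m, hm⟩ := this
  rw [hm, ← two_mul, mul_smul, ofNat_smul_eq_nsmul]
  exact CharTwo.two_nsmul _

/-- A labelling of the points that changes exactly at the wen marks. -/
theorem exists_labels {w : Word} (hw : EvenWens w) : ∃ f : ℕ × ℕ → ZMod 2, ∀ k s, w[k]? = some s →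
    ∀ j, f (edgeEnds s k j).1 + f (edgeEnds s k j).2 = if s = tau j then 1 else 0 := by
  have h : wenCochain w ∈ LinearMap.range (boundary w).dualMap := by
    rw [LinearMap.range_dualMap_eq_dualAnnihilator_ker, Submodule.mem_dualAnnihilator]
    exact fun z hz => wenCochain_eq_zero hw hz
  obtain ⟨g, hg⟩ := h
  -- The functional `g` restricted to points is the labelling; its coboundary is tested on the
  -- single piece `(k, j)`.
  refine ⟨fun P => g (pt P), fun k s hk j => ?_⟩
  have h1 := LinearMap.congr_fun hg (pt (k, j))
  rw [LinearMap.dualMap_apply, boundary, Finsupp.linearCombination_single, one_smul, edgeBoundary,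
    wenCochain_apply] at h1
  simp only [hk, map_add] at h1
  rw [h1]
  split_ifs with hs
  · subst hs
    rw [Finset.sum_eq_single k]
    · simp [wenPoint, hk]
    · intro l _ hl
      simp [wenPoint, hl.symm]
    · exact fun h => absurd (mem_wenLines.2 ⟨j, hk⟩) h
  · refine Finset.sum_eq_zero fun l hl => ?_
    obtain ⟨i, hi⟩ := mem_wenLines.1 hl
    rw [Finsupp.single_apply, if_neg]
    rintro ⟨⟩
    apply hs
    rw [hk, Option.some.injEq] at hi
    simp [hk, hi]

/-! ### Reading a labelling line by line -/

theorem labelStep_map {i : ℕ} {e : Elem} {g h : ℕ → Bool} (r : ℕ) (hl : ∀ p < i, g p = h p)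
    (hr : ∀ p, g (i + e.inp + p) = h (i + e.out + p))
    (he : match e with
      | .cross _ => g i = h (i + 1) ∧ g (i + 1) = h i
      | .wen => h i = !g i
      | .cap _ => h i = h (i + 1)
      | .cup => g i = g (i + 1)) :
    LabelStep ⟨i, e⟩ ((List.range (i + e.inp + r)).map g) ((List.range (i + e.out + r)).map h) := by
  induction i generalizing g h with
  | zero =>
    have hr' : (List.range r).map (fun p => g (0 + e.inp + p)) =
        (List.range r).map (fun p => h (0 + e.out + p)) := List.map_congr_left fun p _ => hr p
    have hsplit : ∀ (f : ℕ → Bool) n, (List.range (n + r)).map f =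
        (List.range n).map f ++ (List.range r).map fun p => f (n + p) := by
      intro f n
      rw [List.range_add, List.map_append, List.map_map]
      rfl
    rw [hsplit, hsplit, hr']
    generalize (List.range r).map (fun p => h (0 + e.out + p)) = l
    cases e with
    | cross k =>
      obtain ⟨h1, h2⟩ := he
      have := LabelStep.cross k (g 0) (g 1) l
      rw [h1, h2] at this
      simpa [Elem.inp, Elem.out, List.range_succ, h1, h2] using this
    | wen =>
      have := LabelStep.wen (g 0) l
      rw [← he] at this
      simpa [Elem.inp, Elem.out, List.range_succ] using this
    | cap d =>
      have := LabelStep.cap d (h 0) l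
      simpa [Elem.inp, Elem.out, List.range_succ, ← show h 0 = h 1 from he] using this
    | cup =>
      have := LabelStep.cup (g 0) l
      simpa [Elem.inp, Elem.out, List.range_succ, ← show g 0 = g 1 from he] using this
  | succ i ih =>
    have := ih (g := fun p => g (p + 1)) (h := fun p => h (p + 1))
      (fun p hp => hl (p + 1) (by omega))
      (fun p => by
        have := hr p
        rwa [show i + 1 + e.inp + p = i + e.inp + p + 1 by omega,
          show i + 1 + e.out + p = i + e.out + p + 1 by omega] at this)
      (by cases e <;> simpa using he)
    rw [show i + 1 + e.inp + r = i + e.inp + r + 1 by omega,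
      show i + 1 + e.out + r = i + e.out + r + 1 by omega, List.range_succ_eq_map,
      List.range_succ_eq_map, List.map_cons, List.map_cons, List.map_map, List.map_map, hl 0 (by omega)]
    exact .succ _ this

theorem Slice.Step.length_eq {s : Slice} {L M : List Dir} (h : s.Step L M) :
    ∃ r, L.length = s.pos + s.elem.inp + r ∧ M.length = s.pos + s.elem.out + r := by
  obtain ⟨pre, u, v, post, hp, hf, rfl, rfl⟩ := h
  refine ⟨post.length, ?_⟩
  have : u.length = s.elem.inp ∧ v.length = s.elem.out := by
    generalize s.elem = e at hf
    cases hf <;> exact ⟨rfl, rfl⟩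
  simp [hp, this, add_assoc]

/-- The labels of the first `n` points on the line `k`. -/
def labels (f : ℕ × ℕ → ZMod 2) (k n : ℕ) : List Bool :=
  (List.range n).map fun p => decide (f (k, p) = 1)

theorem labelStep_labels {f : ℕ × ℕ → ZMod 2} {k : ℕ} {s : Slice}
    (hf : ∀ j, f (edgeEnds s k j).1 + f (edgeEnds s k j).2 = if s = tau j then 1 else 0)
    {L M : List Dir} (h : s.Step L M) : LabelStep s (labels f k L.length) (labels f (k + 1) M.length) := by
  obtain ⟨r, hL, hM⟩ := h.length_eq
  rw [hL, hM]
  have h0 : ∀ a b : ZMod 2, a + b = 0 → decide (a = 1) = decide (b = 1) := by decide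
  have h1 : ∀ a b : ZMod 2, a + b = 1 → decide (b = 1) = !decide (a = 1) := by decide
  obtain ⟨i, e⟩ := s
  refine labelStep_map r (fun p hp => ?_) (fun p => ?_) ?_
  · apply h0
    have := hf p
    cases e <;> simp only [edgeEnds] at this <;> grind
  · apply h0
    cases e with
    | cross c =>
      have := hf (i + 2 + p)
      simp only [edgeEnds] at this
      simp only [Elem.inp, Elem.out]
      grind
    | wen =>
      have := hf (i + 1 + p)
      simp only [edgeEnds] at this
      simp only [Elem.inp, Elem.out]
      grind
    | cap d =>
      -- Piece `i` is the maximum itself, so the strands to its right start at number `i + 1`.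
      have := hf (i + 1 + p)
      simp only [edgeEnds] at this
      simp only [Elem.inp, Elem.out]
      grind
    | cup =>
      have := hf (i + 1 + p)
      simp only [edgeEnds] at this
      simp only [Elem.inp, Elem.out]
      grind
  · have hi := hf i
    have hi' := hf (i + 1)
    cases e with
    | cross c => exact ⟨h0 _ _ (by simpa [edgeEnds] using hi), h0 _ _ (by simpa [edgeEnds] using hi')⟩
    | wen => exact h1 _ _ (by simpa [edgeEnds] using hi)
    | cap d => exact h0 _ _ (by simpa [edgeEnds] using hi)
    | cup => exact h0 _ _ (by simpa [edgeEnds] using hi)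

theorem labelled_labels {f : ℕ × ℕ → ZMod 2} {w : Word} {L M : List Dir} (h : Run w L M) :
    ∀ k, (∀ l s, w[l]? = some s → ∀ j, f (edgeEnds s (k + l) j).1 + f (edgeEnds s (k + l) j).2 =
      if s = tau j then 1 else 0) →
    Labelled w (labels f k L.length) (labels f (k + w.length) M.length) := by
  induction h with
  | nil L => exact fun k _ => .nil _
  | @cons s w L M N hs _ ih =>
    intro k hf
    refine .cons (labelStep_labels (hf 0 s rfl) hs) ?_
    have := ih (k + 1) fun l t ht => by
      rw [show k + 1 + l = k + (l + 1) by omega]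
      exact hf (l + 1) t ht
    rwa [show k + 1 + w.length = k + (s :: w).length by simp; omega] at this

theorem labelled_of_evenWens {w : Word} (h : Run w [] []) (hw : EvenWens w) : Labelled w [] [] := by
  obtain ⟨f, hf⟩ := exists_labels hw
  exact labelled_labels h 0 (by simpa using hf)

theorem evenWens_of_wenFree {w : Word} (hw : WenFree w) : EvenWens w := by
  intro P
  have : {k : ℕ | ∃ i, w[k]? = some (tau i) ∧ SameComponent w P (k, i)} = ∅ := by
    ext k
    simp only [Set.mem_ofPred_eq, Set.mem_empty_iff_false, iff_false]
    rintro ⟨i, hi, _⟩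
    exact hw _ (List.mem_of_getElem? hi) rfl
  rw [this]
  simp

theorem BraidDiagram.IsWelded.closable {n : ℕ} {b : BraidDiagram n} (hb : b.IsWelded) :
    b.Closable := by
  refine evenWens_of_wenFree fun s hs => ?_
  simp only [BraidDiagram.closed, closureTop, closureBottom, List.mem_append, List.mem_map] at hs
  rcases hs with (⟨_, _, rfl⟩ | hs) | ⟨_, _, rfl⟩
  · simp
  · exact hb s hs
  · simp

end ExtWelded


theorem proposition2p1 (l : ExtWelded.Link) :
    ∃ (n : ℕ) (b : ExtWelded.BraidDiagram n) (h : b.Closable),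
      (b.closure h).toLink = l ∧
      ∃ c : ExtWelded.BraidDiagram n, c.IsWelded ∧ b.Equivalent c := by
  induction l using Quotient.inductionOn with
  | h D =>
    obtain ⟨u, hu, hus⟩ := ExtWelded.exists_wenFree
      (ExtWelded.labelled_of_evenWens D.closed D.even_wens) (ExtWelded.run_iff.1 D.closed)
    obtain ⟨n, b, hb, hbs⟩ := ExtWelded.exists_braid hu
      (hus.runF_eq ▸ ExtWelded.run_iff.1 D.closed)
    -- The braid from Alexander's theorem has no marks, hence can be closed and is itself the
    -- required welded braid.
    exact ⟨n, b, hb.closable, Quotient.sound (hus.trans hbs).symm.equivalent, b, hb,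
      Relation.EqvGen.refl _⟩
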